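/- All graphs are finite and loopless; multiple edges are allowed. Let $m\ge 1$ be an integer. For a graph $G$ and $S\subseteq V(G)$, let $\omega(G)$ be the number of connected components of $G$ and let $G\setminus S$ be the graph obtained from $G$ by deleting the vertices of $S$. A graph is *$m$-tree-connected* if it has $m$ pairwise edge-disjoint spanning trees (a one-vertex graph is $m$-tree-connected, the graph without vertices is not). The *$m$-tree-connected components* of $G$ are its maximal induced $m$-tree-connected subgraphs; their vertex sets form a partition $P$ of $V(G)$, and $$\Omega_m(G)=|P|-\frac1m\,e_G(P),$$ where $e_G(P)$ is the number of edges of $G$ whose ends lie in different parts of $P$. For a real number $t>0$, a graph $G$ is *$t$-tough* if $\omega(G\setminus S)\le\max\{1,|S|/t\}$ for all $S\subseteq V(G)$, and *$m$-strongly $t$-tough* if $\Omega_m(G\setminus S)\le\max\{1,|S|/t\}$ for all $S\subseteq V(G)$. **Theorem.** Let $m\ge 1$ be an integer and let $G$ be an $(m^2+m-1)$-tough graph. 1. If $|V(G)|\ge (m^2+3m+2)/2$, then $G$ is $m$-strongly $m$-tough, that is, $\Omega_m(G\setminus S)\le\max\{1,|S|/m\}$ for all $S\subseteq V(G)$. 2.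 If $|V(G)|\ge 2m$, then $G$ has an $m$-tree-connected spanning subgraph $H$ with maximum degree $\Delta(H)\le 2m+1$. -/

import Mathlib

/-!
Finite loopless multigraphs are Mathlib's `Graph α β` (vertices in `α`, edges in `β`).
-/

namespace Graph

variable {α β : Type*}

/-- There is a walk from `x` to `y` in `G`. -/
def Reachable (G : Graph α β) (x y : α) : Prop :=
  Relation.ReflTransGen G.Adj x y

/-- `G` is nonnull and any two of its vertices are joined by a walk. -/
def Connected (G : Graph α β) : Prop :=
  V(G).Nonempty ∧ ∀ x ∈ V(G), ∀ y ∈ V(G), G.Reachable x y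

/-- `G` has no cycle: no edge `e` lies on a cycle, that is, the ends of `e` are not joined by a
walk that avoids `e` (in particular there are no loops and no parallel edges). -/
def IsAcyclic (G : Graph α β) : Prop :=
  ∀ e x y, G.IsLink e x y → ¬ (G.deleteEdges {e}).Reachable x y

/-- A tree is a connected graph without cycles. -/
def IsTree (G : Graph α β) : Prop :=
  G.Connected ∧ G.IsAcyclic

/-- The vertex sets of the connected components of `G`. -/
def componentSets (G : Graph α β) : Set (Set α) :=
  {C | ∃ x ∈ V(G), C = {y | y ∈ V(G) ∧ G.Reachable x y}}

/-- `ω(G)`, the number of components of `G`. -/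
noncomputable def numComponents (G : Graph α β) : ℕ :=
  G.componentSets.ncard

/-- `G` is `m`-tree-connected: it has `m` pairwise edge-disjoint spanning trees. The trees are
indexed, so that a one-vertex graph, whose spanning tree has no edges, is `m`-tree-connected. -/
def IsTreeConnected (m : ℕ) (G : Graph α β) : Prop :=
  ∃ T : Fin m → Graph α β, (∀ i, T i ≤s G ∧ (T i).IsTree) ∧
    Pairwise fun i j => Disjoint E(T i) E(T j)

/-- The partition of `V(G)` into the vertex sets of the `m`-tree-connected components of `G`,
which are the maximal induced `m`-tree-connected subgraphs of `G`. -/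
def treeComponentSets (m : ℕ) (G : Graph α β) : Set (Set α) :=
  {X | Maximal (fun Y : Set α => Y ⊆ V(G) ∧ IsTreeConnected m (G.induce Y)) X}

/-- The edges of `G` whose ends lie in different parts of `P`. -/
def crossingEdges (G : Graph α β) (P : Set (Set α)) : Set β :=
  {e | ∃ x y, G.IsLink e x y ∧ ∃ A ∈ P, ∃ B ∈ P, A ≠ B ∧ x ∈ A ∧ y ∈ B}

/-- `Ω_m(G) = |P| - e_G(P) / m`, where `P` is the partition of `V(G)` into the vertex sets of the
`m`-tree-connected components of `G`. -/
noncomputable def Omega (m : ℕ) (G : Graph α β) : ℝ :=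
  ((treeComponentSets m G).ncard : ℝ)
    - (1 / (m : ℝ)) * ((G.crossingEdges (treeComponentSets m G)).ncard : ℝ)

/-- `G` is `t`-tough: `ω(G ∖ S) ≤ max {1, |S| / t}` for all `S ⊆ V(G)`. -/
def IsTough (t : ℝ) (G : Graph α β) : Prop :=
  ∀ S : Set α, S ⊆ V(G) →
    ((G.deleteVerts S).numComponents : ℝ) ≤ max 1 ((1 / t) * (S.ncard : ℝ))

/-- `G` is `m`-strongly `t`-tough: `Ω_m(G ∖ S) ≤ max {1, |S| / t}` for all `S ⊆ V(G)`. -/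
def IsStronglyTough (m : ℕ) (t : ℝ) (G : Graph α β) : Prop :=
  ∀ S : Set α, S ⊆ V(G) →
    Omega m (G.deleteVerts S) ≤ max 1 ((1 / t) * (S.ncard : ℝ))

/-- The degree of `v`: the number of edges incident to `v` (`G` being loopless). -/
noncomputable def edgeDegree (G : Graph α β) (v : α) : ℕ :=
  (G.incidenceSet v).ncard

end Graph

/-!
Let `I` be a maximal set of edges that spans at most `m (|X| - 1)` edges in every nonempty vertex
set `X`. By the matroid union theorem for the cycle matroid, the `m`-tree-connected components are
the maximal sets `X` for which equality holds, and all edges between different components lie in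
`I`. Hence `m Ω_m = m |V| - |I|`.

For the first part, suppose that `G \ S` has at least two components, and contract them to the
vertices of a multigraph. There `m Ω_m(G \ S)` is the sum of the charges `m - d / 2`, where `d` is
the degree. Since `(m - d / 2) (d + 1) ≤ m² + m - 1 - d` (for `m = 1` all degrees are `0`), a
weighted Caro–Wei argument gives pairwise nonadjacent components `A` for which the sum of
`m² + m - 1 - d(A)` is at least `m Ω_m(G \ S)`. Deleting `S` and the neighbours of these components
separates them from each other, and toughness bounds the sum by `|S|`. Toughness says nothing about
complete graphs, for which the edges between the components are counted directly; this is where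
`|V| ≥ (m² + 3m + 2) / 2` is needed, because a graph that is not complete has at least
`2 (m² + m - 1) + 2` vertices.

For the second part, choose a union of `m` edge-disjoint spanning trees whose degrees exceed
`2m + 1` by the least possible total amount. If this amount is positive, the vertices whose degree
cannot be lowered by exchanges form a set `S` of vertices of degree at least `2m + 1`, such that the
remaining trees still determine `Ω_m(G \ S)`; counting edges gives `m Ω_m(G \ S) > |S| + 2m`, which
contradicts the first part. In a complete graph whose vertices are labelled by the integers modulo
`n`, the edges with label sum `k` or `k + 1` contain a Hamiltonian path, and `m` disjoint such pairs
of matchings have maximum degree at most `2m`.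
-/

namespace TreeToughness

open Graph Finset

open scoped Classical

section MatroidPacking

variable {ι β : Type*} {M : Matroid β} {I : Finset β} {F F' : ι → Finset β} {e f : β}

/-- A family of pairwise disjoint independent subsets of `I`: a set that is independent in a union
of copies of `M`, together with a colouring of its elements by the copies. -/
structure IndepPacking (M : Matroid β) (I : Finset β) (F : ι → Finset β) : Prop where
  subset : ∀ i, F i ⊆ I
  indep : ∀ i, M.Indep (F i)
  disjoint : Pairwise fun i j => Disjoint (F i) (F j)

lemma IndepPacking.update (h : IndepPacking M I F) {i : ι} {K : Finset β} (hK : K ⊆ I)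
    (hindep : M.Indep K) (hdisj : ∀ j ≠ i, Disjoint (F j) K) :
    IndepPacking M I (Function.update F i K) where
  subset j := by
    rcases eq_or_ne j i with rfl | hj
    · simpa using hK
    · simpa [hj] using h.subset j
  indep j := by
    rcases eq_or_ne j i with rfl | hj
    · simpa using hindep
    · simpa [hj] using h.indep j
  disjoint j k hjk := by
    rcases eq_or_ne j i with rfl | hj
    · simpa [hjk.symm] using (hdisj k hjk.symm).symm
    · rcases eq_or_ne k i with rfl | hk
      · simpa [hj] using hdisj j hj
      · simpa [hj, hk] using h.disjoint hjk

/-- `F` is a packing of independent subsets of `I` with as many elements as possible, and `e` is an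
element of `I` that it leaves uncovered. These are the states of the augmenting path argument. -/
structure IsMaxPackingMissing [Fintype ι] (M : Matroid β) (I : Finset β) (F : ι → Finset β)
    (e : β) : Prop extends IndepPacking M I F where
  mem : e ∈ I
  notMem : ∀ i, e ∉ F i
  sum_card_le : ∀ F' : ι → Finset β, IndepPacking M I F' → ∑ i, #(F' i) ≤ ∑ i, #(F i)

/-- One step of the augmenting path argument: the uncovered element enters a class, and another
element of the circuit that it closes there becomes uncovered. -/
inductive Exchange (M : Matroid β) : (ι → Finset β) × β → (ι → Finset β) × β → Prop
  | mk (F : ι → Finset β) {e f : β} (i : ι) (hf : f ∈ F i) (hfC : f ∈ M.fundCircuit e (F i)) :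
    Exchange M (F, e) (Function.update F i (insert e ((F i).erase f)), f)

lemma closure_exchange_inter_eq {J A : Set β} (hJ : M.Indep J) (he : e ∈ M.closure J)
    (heJ : e ∉ J) (hfC : f ∈ M.fundCircuit e J) (hf : f ∈ J) (hA : M.fundCircuit e J ⊆ A) :
    M.closure (insert e (J \ {f}) ∩ A) = M.closure (J ∩ A) := by
  have hcirc : M.fundCircuit e J \ {e} ⊆ J ∩ A := fun g hg =>
    ⟨(M.fundCircuit_subset_insert e J hg.1).resolve_left hg.2, hA hg.1⟩
  have he_mem : e ∈ M.closure (J ∩ A) := M.closure_subset_closure hcirc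
    ((hJ.fundCircuit_isCircuit he heJ).mem_closure_sdiff_singleton_of_mem
      (M.mem_fundCircuit e J))
  have hef : e ≠ f := fun h => heJ (h ▸ hf)
  have he_notMem : e ∉ M.closure ((J ∩ A) \ {f}) := fun h => by
    have hindep := (hJ.mem_fundCircuit_iff he heJ).1 hfC
    rw [← Set.insert_sdiff_singleton_comm hef,
      (hJ.sdiff _).insert_indep_iff_of_notMem (fun h => heJ h.1)] at hindep
    exact hindep.2 (M.closure_subset_closure (Set.sdiff_subset_sdiff_left Set.inter_subset_left) h)
  have hins : insert f ((J ∩ A) \ {f}) = J ∩ A := by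
    rw [Set.insert_sdiff_singleton, Set.insert_eq_of_mem (Set.mem_inter hf (hA hfC))]
  rw [Set.insert_inter_of_mem (hA (M.mem_fundCircuit e J)), ← Set.inter_sdiff_right_comm,
    M.closure_insert_congr (f := f) ⟨by rwa [hins], he_notMem⟩, hins]

namespace IsMaxPackingMissing

variable [Fintype ι]

lemma mem_closure (h : IsMaxPackingMissing M I F e) (he : e ∈ M.E) (i : ι) :
    e ∈ M.closure (F i) := by
  by_contra hcl
  have hindep : M.Indep (insert e (F i) : Finset β) := by
    rw [coe_insert, (h.indep i).insert_indep_iff_of_notMem (h.notMem i)]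
    exact ⟨he, hcl⟩
  have hpack : IndepPacking M I (Function.update F i (insert e (F i))) :=
    h.update (insert_subset h.mem (h.subset i)) hindep fun j hj =>
      disjoint_insert_right.2 ⟨h.notMem j, h.disjoint hj⟩
  refine (h.sum_card_le _ hpack).not_gt (sum_lt_sum (fun j _ => ?_) ⟨i, mem_univ i, ?_⟩)
  · rcases eq_or_ne j i with rfl | hj
    · simpa using card_le_card (subset_insert e _)
    · simp [hj]
  · simp [h.notMem i]

lemma exchange (h : IsMaxPackingMissing M I F e) (he : e ∈ M.E)
    (hstep : Exchange M (F, e) (F', f)) : IsMaxPackingMissing M I F' f := by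
  obtain ⟨_, i, hf, hfC⟩ := hstep
  have hef : e ≠ f := fun hef => h.notMem i (hef ▸ hf)
  have hindep : M.Indep (insert e ((F i).erase f) : Finset β) := by
    rw [coe_insert, coe_erase, Set.insert_sdiff_singleton_comm hef]
    exact ((h.indep i).mem_fundCircuit_iff (h.mem_closure he i) (h.notMem i)).1 hfC
  refine ⟨h.update (insert_subset h.mem ((erase_subset _ _).trans (h.subset i))) hindep
    fun j hj => disjoint_insert_right.2 ⟨h.notMem j, (h.disjoint hj).mono_right
      (erase_subset _ _)⟩, h.subset i hf, fun j => ?_, fun G hG => ?_⟩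
  · rcases eq_or_ne j i with rfl | hj
    · simp [hef.symm]
    · simpa [hj] using disjoint_right.1 (h.disjoint hj) hf
  · refine (h.sum_card_le G hG).trans_eq (sum_congr rfl fun j _ => ?_)
    rcases eq_or_ne j i with rfl | hj
    · rw [Function.update_self, card_insert_of_notMem (by simp [h.notMem]),
        card_erase_add_one hf]
    · simp [hj]

lemma closure_inter_eq (h : IsMaxPackingMissing M I F e) (he : e ∈ M.E)
    (hstep : Exchange M (F, e) (F', f)) {A : Set β} (heA : e ∈ A)
    (hA : ∀ F'' g, Exchange M (F, e) (F'', g) → g ∈ A) (j : ι) :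
    M.closure (F' j ∩ A) = M.closure (F j ∩ A) := by
  obtain ⟨_, i, hf, hfC⟩ := hstep
  rcases eq_or_ne j i with rfl | hj
  · rw [Function.update_self, coe_insert, coe_erase]
    refine closure_exchange_inter_eq (h.indep j) (h.mem_closure he j) (h.notMem j) hfC hf
      fun g hg => ?_
    rcases M.fundCircuit_subset_insert e _ hg with rfl | hgF
    · exact heA
    · exact hA _ g (.mk F j hgF hg)
  · rw [Function.update_of_ne hj]

lemma of_reflTransGen (h : IsMaxPackingMissing M I F e) (hI : (I : Set β) ⊆ M.E)
    (hchain : Relation.ReflTransGen (Exchange M) (F, e) (F', f)) :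
    IsMaxPackingMissing M I F' f := by
  suffices ∀ p, Relation.ReflTransGen (Exchange M) (F, e) p → IsMaxPackingMissing M I p.1 p.2 from
    this _ hchain
  intro p hp
  induction hp with
  | refl => exact h
  | tail _ hstep ih => exact ih.exchange (hI ih.mem) hstep

lemma closure_inter_eq_of_reflTransGen (h : IsMaxPackingMissing M I F e) (hI : (I : Set β) ⊆ M.E)
    {A : Set β} (hA : ∀ F' f, Relation.ReflTransGen (Exchange M) (F, e) (F', f) → f ∈ A)
    (hchain : Relation.ReflTransGen (Exchange M) (F, e) (F', f)) (i : ι) :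
    M.closure (F' i ∩ A) = M.closure (F i ∩ A) := by
  suffices ∀ p, Relation.ReflTransGen (Exchange M) (F, e) p →
      M.closure (p.1 i ∩ A) = M.closure (F i ∩ A) from this _ hchain
  intro p hp
  induction hp with
  | refl => rfl
  | tail hp hstep ih =>
    have hmiss := h.of_reflTransGen hI hp
    rw [← ih]
    exact hmiss.closure_inter_eq (hI hmiss.mem) hstep (hA _ _ hp)
      (fun F'' g hg => hA F'' g (hp.tail hg)) i

end IsMaxPackingMissing

lemma exists_max_indepPacking [Fintype ι] (M : Matroid β) (I : Finset β) :
    ∃ F : ι → Finset β, IndepPacking M I F ∧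
      ∀ F' : ι → Finset β, IndepPacking M I F' → ∑ i, #(F' i) ≤ ∑ i, #(F i) := by
  have hfin : {F : ι → Finset β | IndepPacking M I F}.Finite :=
    (Fintype.piFinset fun _ => I.powerset).finite_toSet.subset fun F hF =>
      mem_coe.2 (Fintype.mem_piFinset.2 fun i => mem_powerset.2 (hF.subset i))
  have hempty : IndepPacking M I fun _ : ι => ∅ :=
    ⟨fun _ => empty_subset I, fun _ => by simp, fun _ _ _ => disjoint_empty_left _⟩
  obtain ⟨F, hF, hmax⟩ := Set.exists_max_image _ (fun F => ∑ i, #(F i)) hfin ⟨_, hempty⟩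
  exact ⟨F, hF, hmax⟩

/-- The hard direction of the matroid union theorem. The certificate `A` consists of the elements
that become uncovered in some sequence of exchanges. -/
theorem exists_indepPacking_spanning (ι : Type*) [Finite ι] (hI : (I : Set β) ⊆ M.E) :
    ∃ (F : ι → Finset β) (A : Set β), IndepPacking M I F ∧ A ⊆ I ∧
      (∀ e ∈ I, (∀ i, e ∉ F i) → e ∈ A) ∧ ∀ i, A ⊆ M.closure (F i ∩ A) := by
  cases nonempty_fintype ι
  obtain ⟨F, hF, hmax⟩ := exists_max_indepPacking (ι := ι) M I
  have hmiss {e : β} (he : e ∈ I) (heF : ∀ i, e ∉ F i) : IsMaxPackingMissing M I F e :=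
    ⟨hF, he, heF, hmax⟩
  let A : Set β := {f | ∃ e ∈ I, (∀ i, e ∉ F i) ∧
    ∃ F', Relation.ReflTransGen (Exchange M) (F, e) (F', f)}
  refine ⟨F, A, hF, ?_, fun e he heF => ⟨e, he, heF, F, .refl⟩, ?_⟩
  · rintro f ⟨e, he, heF, F', hchain⟩
    exact ((hmiss he heF).of_reflTransGen hI hchain).mem
  · rintro i f ⟨e, he, heF, F', hchain⟩
    have hmiss' := (hmiss he heF).of_reflTransGen hI hchain
    have hcl := hmiss'.mem_closure (hI hmiss'.mem) i
    have hcirc := (hmiss'.indep i).fundCircuit_isCircuit hcl (hmiss'.notMem i)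
    rw [← (hmiss he heF).closure_inter_eq_of_reflTransGen hI (A := A)
      (fun F'' g hg => ⟨e, he, heF, F'', hg⟩) hchain i]
    suffices M.fundCircuit f (F' i) \ {f} ⊆ F' i ∩ A from M.closure_subset_closure this
      (hcirc.mem_closure_sdiff_singleton_of_mem (M.mem_fundCircuit f _))
    intro g hg
    have hgF := (M.fundCircuit_subset_insert f _ hg.1).resolve_left hg.2
    exact ⟨hgF, e, he, heF, _, hchain.tail (.mk F' i hgF hg.1)⟩

end MatroidPacking

section LinearMatroid

variable {K W β : Type*} [DivisionRing K] [AddCommGroup W] [Module K W] {v : β → W} {I J : Set β}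
  {e : β}

lemma finrank_span_image_eq_ncard (hI : LinearIndepOn K v I) :
    Module.finrank K (Submodule.span K (v '' I)) = I.ncard := by
  rw [Set.image_eq_range, Module.finrank_eq_nat_card_basis (Module.Basis.span hI),
    Nat.card_coe_set_eq]

lemma exists_linearIndepOn_insert_of_ncard_lt (hI : LinearIndepOn K v I) (hIfin : I.Finite)
    (hJ : LinearIndepOn K v J) (hcard : I.ncard < J.ncard) :
    ∃ e ∈ J, e ∉ I ∧ LinearIndepOn K v (insert e I) := by
  by_contra! h
  have hspan : v '' J ⊆ Submodule.span K (v '' I) := by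
    rintro _ ⟨e, he, rfl⟩
    by_cases heI : e ∈ I
    · exact Submodule.subset_span ⟨e, heI, rfl⟩
    · by_contra hv
      exact h e he heI ((linearIndepOn_insert heI).2 ⟨hI, hv⟩)
  have := FiniteDimensional.span_of_finite K (hIfin.image v)
  have hrank := Submodule.finrank_mono (Submodule.span_le.2 hspan)
  rw [finrank_span_image_eq_ncard hI, finrank_span_image_eq_ncard hJ] at hrank
  exact hrank.not_gt hcard

variable (K v) in
/-- The matroid on `β` represented by the family of vectors `v`. -/
def linearMatroid : Matroid β :=
  (IndepMatroid.ofFinitaryCardAugment Set.univ (LinearIndepOn K v)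
    (linearIndepOn_empty K v) (fun _ _ hJ hIJ => hJ.mono hIJ)
    (fun _ _ hI hIfin hJ _ => exists_linearIndepOn_insert_of_ncard_lt hI hIfin hJ)
    (fun _ h => linearIndepOn_of_finite _ h)
    (fun _ _ => Set.subset_univ _)).matroid

lemma linearMatroid_indep_iff : (linearMatroid K v).Indep I ↔ LinearIndepOn K v I := by
  simp [linearMatroid, IndepMatroid.ofFinitaryCardAugment]

lemma mem_span_of_mem_closure_linearMatroid (hI : LinearIndepOn K v I)
    (he : e ∈ (linearMatroid K v).closure I) : v e ∈ Submodule.span K (v '' I) := by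
  rw [(linearMatroid_indep_iff.2 hI).mem_closure_iff', linearMatroid_indep_iff] at he
  by_contra hv
  have heI : e ∉ I := fun h => hv (Submodule.subset_span ⟨e, h, rfl⟩)
  exact heI (he.2 ((linearIndepOn_insert heI).2 ⟨hI, hv⟩))

end LinearMatroid

/-- A choice of two ends for every edge label. It encodes a multigraph whose edge set varies: a set
of edges is just a set of labels. The order of the two ends is only a reference orientation. -/
structure EdgeEnds (α β : Type*) where
  src : β → α
  tgt : β → α

namespace EdgeEnds

section Connectivity

variable {α β : Type*} {D : EdgeEnds α β} {F F' : Set β} {x y z : α} {e : β}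

/-- The vertices `x` and `y` are joined by a walk with edges in `F`. -/
def Conn (D : EdgeEnds α β) (F : Set β) : α → α → Prop :=
  Relation.EqvGen fun x y => ∃ e ∈ F, D.src e = x ∧ D.tgt e = y

/-- Any two vertices of `V` are joined by a walk with edges in `F`; the walk may leave `V`. -/
def Connects (D : EdgeEnds α β) (F : Set β) (V : Finset α) : Prop :=
  ∀ x ∈ V, ∀ y ∈ V, D.Conn F x y

/-- All ends of edges in `F` are in `V`. -/
def EndsIn (D : EdgeEnds α β) (F : Finset β) (V : Finset α) : Prop :=
  ∀ e ∈ F, D.src e ∈ V ∧ D.tgt e ∈ V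

lemma Conn.refl (F : Set β) (x : α) : D.Conn F x x := Relation.EqvGen.refl x

lemma Conn.symm (h : D.Conn F x y) : D.Conn F y x := Relation.EqvGen.symm _ _ h

lemma Conn.trans (h : D.Conn F x y) (h' : D.Conn F y z) : D.Conn F x z :=
  Relation.EqvGen.trans _ _ _ h h'

lemma conn_of_mem (he : e ∈ F) : D.Conn F (D.src e) (D.tgt e) :=
  Relation.EqvGen.rel _ _ ⟨e, he, rfl, rfl⟩

lemma Conn.lift {r : α → α → Prop} (hr : Equivalence r) (h : ∀ e ∈ F, r (D.src e) (D.tgt e))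
    (hc : D.Conn F x y) : r x y := by
  induction hc with
  | rel x y hxy => obtain ⟨e, he, rfl, rfl⟩ := hxy; exact h e he
  | refl x => exact hr.refl x
  | symm x y _ ih => exact hr.symm ih
  | trans x y z _ _ ihxy ihyz => exact hr.trans ihxy ihyz

lemma equivalence_conn (D : EdgeEnds α β) (F : Set β) : Equivalence (D.Conn F) :=
  ⟨Conn.refl F, Conn.symm, Conn.trans⟩

lemma Conn.mono (h : F ⊆ F') (hc : D.Conn F x y) : D.Conn F' x y :=
  hc.lift (D.equivalence_conn F') fun _ he => conn_of_mem (h he)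

lemma Conn.restrict {U : Set α} (hU : ∀ e ∈ F, D.src e ∈ U ↔ D.tgt e ∈ U)
    (h : D.Conn F x y) (hx : x ∈ U) : D.Conn {e ∈ F | D.src e ∈ U ∧ D.tgt e ∈ U} x y := by
  have hr : Equivalence fun x y : α => (x ∈ U ↔ y ∈ U) ∧
      (x ∈ U → D.Conn {e ∈ F | D.src e ∈ U ∧ D.tgt e ∈ U} x y) :=
    { refl := fun x => ⟨Iff.rfl, fun _ => Conn.refl _ _⟩
      symm := fun h => ⟨h.1.symm, fun hy => (h.2 (h.1.2 hy)).symm⟩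
      trans := fun h h' => ⟨h.1.trans h'.1, fun hx => (h.2 hx).trans (h'.2 (h.1.1 hx))⟩ }
  exact (h.lift hr fun e he => ⟨hU e he, fun hs =>
    conn_of_mem ⟨he, hs, (hU e he).1 hs⟩⟩).2 hx

/-- The edge ends of the multigraph in which every vertex `x` is identified to `p x`. -/
def map {ι : Type*} (D : EdgeEnds α β) (p : α → ι) : EdgeEnds ι β :=
  ⟨p ∘ D.src, p ∘ D.tgt⟩

lemma Conn.map {ι : Type*} (p : α → ι) (h : D.Conn F x y) :
    (D.map p).Conn {e ∈ F | p (D.src e) ≠ p (D.tgt e)} (p x) (p y) := by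
  have hr := (D.map p).equivalence_conn {e ∈ F | p (D.src e) ≠ p (D.tgt e)}
  refine h.lift (r := fun x y => (D.map p).Conn _ (p x) (p y))
    ⟨fun _ => hr.refl _, hr.symm, hr.trans⟩ fun e he => ?_
  by_cases hp : p (D.src e) = p (D.tgt e)
  · exact hp ▸ hr.refl _
  · exact conn_of_mem (D := D.map p) ⟨he, hp⟩

end Connectivity

section CycleMatroid

variable {α β : Type*} {D : EdgeEnds α β} {x y : α} {e : β} {V : Finset α}

/-- The row of the oriented incidence matrix that belongs to `e`. -/
noncomputable def edgeVec (D : EdgeEnds α β) (e : β) : α →₀ ℚ :=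
  Finsupp.single (D.src e) 1 - Finsupp.single (D.tgt e) 1

/-- The cycle matroid, whose independent sets are the forests; it is represented by the oriented
incidence matrix. -/
noncomputable def cycleMatroid (D : EdgeEnds α β) : Matroid β :=
  linearMatroid ℚ D.edgeVec

lemma conn_iff_mem_span {F : Set β} : D.Conn F x y ↔
    Finsupp.single x (1 : ℚ) - Finsupp.single y 1 ∈ Submodule.span ℚ (D.edgeVec '' F) := by
  constructor
  · refine Conn.lift (r := fun x y => Finsupp.single x (1 : ℚ) - Finsupp.single y 1 ∈
      Submodule.span ℚ (D.edgeVec '' F)) ⟨fun x => by simp, fun h => ?_, fun h h' => ?_⟩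
      fun e he => Submodule.subset_span ⟨e, he, rfl⟩
    · simpa only [neg_sub] using Submodule.neg_mem _ h
    · simpa only [sub_add_sub_cancel] using Submodule.add_mem _ h h'
  · -- The indicator of the class of `x` annihilates the rows of `F`.
    intro h
    let φ : (α →₀ ℚ) →ₗ[ℚ] ℚ :=
      Finsupp.linearCombination ℚ fun z => if D.Conn F x z then (1 : ℚ) else 0
    have hφ : Submodule.span ℚ (D.edgeVec '' F) ≤ LinearMap.ker φ := by
      refine Submodule.span_le.2 ?_
      rintro _ ⟨e, he, rfl⟩
      have : D.Conn F x (D.src e) ↔ D.Conn F x (D.tgt e) :=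
        ⟨fun h => h.trans (conn_of_mem he), fun h => h.trans (conn_of_mem he).symm⟩
      simp [φ, edgeVec, this]
    by_contra hn
    simpa [φ, hn, Conn.refl] using hφ h

lemma conn_of_mem_closure_cycleMatroid {F : Set β} (hF : D.cycleMatroid.Indep F)
    (he : e ∈ D.cycleMatroid.closure F) : D.Conn F (D.src e) (D.tgt e) :=
  conn_iff_mem_span.2 (mem_span_of_mem_closure_linearMatroid (linearMatroid_indep_iff.1 hF) he)

lemma Connects.card_le_card_add_one {F : Finset β} (h : D.Connects F V) : #V ≤ #F + 1 := by
  rcases V.eq_empty_or_nonempty with rfl | ⟨x₀, hx₀⟩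
  · simp
  let S : Finset (α →₀ ℚ) := insert (Finsupp.single x₀ 1) (F.image D.edgeVec)
  have hV : Module.finrank ℚ (Submodule.span ℚ ((Finsupp.single · (1 : ℚ)) '' (V : Set α))) =
      #V := by
    rw [finrank_span_image_eq_ncard, Set.ncard_coe_finset]
    exact (Finsupp.linearIndependent_single_one ℚ α).linearIndepOn _
  have hspan : Submodule.span ℚ ((Finsupp.single · (1 : ℚ)) '' (V : Set α)) ≤
      Submodule.span ℚ S := by
    rw [Submodule.span_le]
    rintro _ ⟨x, hx, rfl⟩
    have hx₀S : Finsupp.single x₀ 1 ∈ Submodule.span ℚ (S : Set (α →₀ ℚ)) :=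
      Submodule.subset_span (by simp [S])
    have hxS := Submodule.span_mono (s := D.edgeVec '' F) (t := (S : Set (α →₀ ℚ)))
      (by simp [S]) (conn_iff_mem_span.1 (h x hx x₀ hx₀))
    simpa using Submodule.add_mem _ hxS hx₀S
  calc #V = Module.finrank ℚ (Submodule.span ℚ ((Finsupp.single · (1 : ℚ)) '' (V : Set α))) :=
        hV.symm
    _ ≤ Module.finrank ℚ (Submodule.span ℚ (S : Set (α →₀ ℚ))) := Submodule.finrank_mono hspan
    _ ≤ #S := finrank_span_finset_le_card S
    _ ≤ #F + 1 := (card_insert_le _ _).trans (Nat.add_le_add_right card_image_le 1)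

/-- The span of the vectors `x - y` for `y ∈ V`: when `x ∈ V`, the space of vectors supported on
`V` with coordinate sum zero. -/
noncomputable def vertexSpan (V : Finset α) (x : α) : Submodule ℚ (α →₀ ℚ) :=
  Submodule.span ℚ (((V.erase x).image fun y => Finsupp.single x (1 : ℚ) - Finsupp.single y 1 :
    Finset (α →₀ ℚ)) : Set (α →₀ ℚ))

lemma sub_mem_vertexSpan (x : α) (hy : y ∈ V) :
    Finsupp.single x (1 : ℚ) - Finsupp.single y 1 ∈ vertexSpan V x := by
  rcases eq_or_ne y x with rfl | hyx
  · simp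
  · exact Submodule.subset_span (mem_image_of_mem _ (mem_erase.2 ⟨hyx, hy⟩))

lemma finrank_vertexSpan_lt (hx : x ∈ V) : Module.finrank ℚ (vertexSpan V x) < #V :=
  ((finrank_span_finset_le_card _).trans card_image_le).trans_lt (card_erase_lt_of_mem hx)

instance (V : Finset α) (x : α) : FiniteDimensional ℚ (vertexSpan V x) :=
  FiniteDimensional.span_finset ℚ _

lemma EndsIn.span_le_vertexSpan {F : Finset β} (hF : D.EndsIn F V) (x : α) :
    Submodule.span ℚ (D.edgeVec '' F) ≤ vertexSpan V x := by
  rw [Submodule.span_le]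
  rintro _ ⟨e, he, rfl⟩
  have hsub := Submodule.sub_mem _ (sub_mem_vertexSpan x (hF e he).2)
    (sub_mem_vertexSpan x (hF e he).1)
  rwa [sub_sub_sub_cancel_left] at hsub

lemma finrank_span_of_indep {F : Finset β} (hF : D.cycleMatroid.Indep F) :
    Module.finrank ℚ (Submodule.span ℚ (D.edgeVec '' (F : Set β))) = #F := by
  rw [finrank_span_image_eq_ncard (linearMatroid_indep_iff.1 hF), Set.ncard_coe_finset]

lemma card_lt_of_indep {F : Finset β} (hF : D.cycleMatroid.Indep F) (hV : D.EndsIn F V)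
    (hne : V.Nonempty) : #F < #V := by
  obtain ⟨x, hx⟩ := hne
  rw [← finrank_span_of_indep hF]
  exact (Submodule.finrank_mono (hV.span_le_vertexSpan x)).trans_lt (finrank_vertexSpan_lt hx)

lemma connects_of_indep {F : Finset β} (hF : D.cycleMatroid.Indep F) (hV : D.EndsIn F V)
    (hcard : #V ≤ #F + 1) : D.Connects F V := by
  intro x hx y hy
  have hrank := finrank_vertexSpan_lt hx
  rw [conn_iff_mem_span, Submodule.eq_of_le_of_finrank_le (hV.span_le_vertexSpan x)
    (by rw [finrank_span_of_indep hF]; omega)]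
  exact sub_mem_vertexSpan x hy

end CycleMatroid

section SparseSets

variable {α β : Type*} {D : EdgeEnds α β} {m : ℕ} {I J E : Finset β} {V X Y : Finset α} {e : β}

/-- The edges of `I` with both ends in `X`. -/
noncomputable def inside (D : EdgeEnds α β) (I : Finset β) (X : Finset α) : Finset β :=
  I.filter fun e => D.src e ∈ X ∧ D.tgt e ∈ X

/-- Every nonempty vertex set `X` spans at most `m (|X| - 1)` edges of `I`. These are the edge sets
that are unions of `m` forests. -/
def Sparse (D : EdgeEnds α β) (m : ℕ) (I : Finset β) : Prop :=
  ∀ X : Finset α, X.Nonempty → #(D.inside I X) + m ≤ m * #X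

/-- The nonempty vertex set `X` spans exactly `m (|X| - 1)` edges of `I`. -/
def Tight (D : EdgeEnds α β) (m : ℕ) (I : Finset β) (X : Finset α) : Prop :=
  X.Nonempty ∧ #(D.inside I X) + m = m * #X

lemma mem_inside : e ∈ D.inside I X ↔ e ∈ I ∧ D.src e ∈ X ∧ D.tgt e ∈ X := mem_filter

lemma inside_subset : D.inside I X ⊆ I := filter_subset _ _

lemma inside_mono (h : X ⊆ Y) : D.inside I X ⊆ D.inside I Y := fun e he => by
  rw [mem_inside] at he ⊢
  exact ⟨he.1, h he.2.1, h he.2.2⟩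

lemma inside_subset_inside (h : I ⊆ J) : D.inside I X ⊆ D.inside J X :=
  filter_subset_filter _ h

lemma inside_inter : D.inside I (X ∩ Y) = D.inside I X ∩ D.inside I Y := by
  ext e
  simp only [mem_inside, mem_inter]
  tauto

lemma inside_inside_of_subset (h : X ⊆ Y) : D.inside (D.inside I Y) X = D.inside I X := by
  ext e
  simp only [mem_inside]
  exact ⟨fun he => ⟨he.1.1, he.2⟩, fun he => ⟨⟨he.1, h he.2.1, h he.2.2⟩, he.2⟩⟩

lemma EndsIn.inside_eq (h : D.EndsIn I V) : D.inside I V = I := filter_true_of_mem h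

lemma endsIn_inside : D.EndsIn (D.inside I X) X := fun _ he => (mem_inside.1 he).2

lemma EndsIn.mono (h : D.EndsIn E V) (hI : I ⊆ E) : D.EndsIn I V := fun e he => h e (hI he)

lemma disjoint_inside (h : Disjoint X Y) : Disjoint (D.inside I X) (D.inside J Y) :=
  disjoint_left.2 fun _ hX hY =>
    disjoint_left.1 h (mem_inside.1 hX).2.1 (mem_inside.1 hY).2.1

lemma card_inside_add_le :
    #(D.inside I X) + #(D.inside I Y) ≤ #(D.inside I (X ∪ Y)) + #(D.inside I (X ∩ Y)) := by
  rw [← card_union_add_card_inter, inside_inter]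
  gcongr
  exact union_subset (inside_mono subset_union_left) (inside_mono subset_union_right)

lemma mul_card_union_add_mul_card_inter (m : ℕ) (X Y : Finset α) :
    m * #(X ∪ Y) + m * #(X ∩ Y) = m * #X + m * #Y := by
  rw [← mul_add, ← mul_add, card_union_add_card_inter]

namespace Sparse

lemma mono (hI : D.Sparse m I) (h : J ⊆ I) : D.Sparse m J := fun X hX =>
  (Nat.add_le_add_right (card_le_card (inside_subset_inside h)) m).trans (hI X hX)

lemma src_ne_tgt (hI : D.Sparse m I) (he : e ∈ I) : D.src e ≠ D.tgt e := by
  intro hloop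
  have hle := hI {D.src e} (singleton_nonempty _)
  have hpos : 0 < #(D.inside I {D.src e}) :=
    card_pos.2 ⟨e, mem_inside.2 ⟨he, by simp [hloop]⟩⟩
  rw [card_singleton, mul_one] at hle
  omega

lemma tight_singleton (hI : D.Sparse m I) (x : α) : D.Tight m I {x} := by
  have hle := hI {x} (singleton_nonempty x)
  refine ⟨singleton_nonempty x, ?_⟩
  rw [card_singleton, mul_one] at hle ⊢
  omega

lemma tight_union_inter (hI : D.Sparse m I) (hX : D.Tight m I X) (hY : D.Tight m I Y)
    (h : (X ∩ Y).Nonempty) : D.Tight m I (X ∪ Y) ∧ D.Tight m I (X ∩ Y) := by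
  have hunion : (X ∪ Y).Nonempty := hX.1.mono subset_union_left
  have hinter_le := hI _ h
  have hunion_le := hI _ hunion
  have hsuper := card_inside_add_le (D := D) (I := I) (X := X) (Y := Y)
  have hcard := mul_card_union_add_mul_card_inter m X Y
  have hXeq := hX.2
  have hYeq := hY.2
  exact ⟨⟨hunion, by omega⟩, ⟨h, by omega⟩⟩

lemma tight_union (hI : D.Sparse m I) (hX : D.Tight m I X) (hY : D.Tight m I Y)
    (h : (X ∩ Y).Nonempty) : D.Tight m I (X ∪ Y) :=
  (hI.tight_union_inter hX hY h).1

lemma tight_inter_of_endsIn (hI : D.Sparse m I) (hV : D.EndsIn I V) (hX : D.Tight m I X)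
    (hXV : (X ∩ V).Nonempty) : D.Tight m I (X ∩ V) := by
  have hinside : D.inside I (X ∩ V) = D.inside I X := by
    rw [inside_inter, hV.inside_eq, inter_eq_left.2 inside_subset]
  have hle := hI _ hXV
  have hcard : m * #(X ∩ V) ≤ m * #X := Nat.mul_le_mul_left m (card_le_card inter_subset_left)
  have hXeq := hX.2
  rw [hinside] at hle
  exact ⟨hXV, by rw [hinside]; omega⟩

end Sparse

lemma sparse_empty : D.Sparse m ∅ := fun X hX => by
  simpa [inside] using Nat.le_mul_of_pos_right m hX.card_pos

end SparseSets

section Packing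

variable {α β : Type*} {D : EdgeEnds α β} {m : ℕ} {I J : Finset β} {V : Finset α}
  {F : Fin m → Finset β}

/-- `F` consists of `m` disjoint subsets of `I`, each of which connects `V`. -/
structure IsConnectingPacking (D : EdgeEnds α β) (I : Finset β) (V : Finset α)
    (F : Fin m → Finset β) : Prop where
  subset : ∀ j, F j ⊆ I
  disjoint : Pairwise fun i j => Disjoint (F i) (F j)
  connects : ∀ j, D.Connects (F j) V

lemma sum_card_le_card_of_pairwise_disjoint {ι : Type*} [Fintype ι] {F : ι → Finset β}
    (hF : ∀ i, F i ⊆ I) (hdisj : Pairwise fun i j => Disjoint (F i) (F j)) :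
    ∑ i, #(F i) ≤ #I := by
  rw [← card_biUnion fun i _ j _ hij => hdisj hij]
  exact card_le_card (biUnion_subset.2 fun i _ => hF i)

/-- The class `U` of `e` with respect to connectedness in `A` is connected by the edges inside `U`
of each member of the packing, so together with `e` it would span too many edges. -/
lemma Sparse.exists_mem_of_spanning (hI : D.Sparse m I) (hV : D.EndsIn I V)
    (hF : IndepPacking D.cycleMatroid I F) {A : Set β} (hAI : A ⊆ I)
    (hA : ∀ i, A ⊆ D.cycleMatroid.closure (F i ∩ A)) {e : β} (he : e ∈ A) : ∃ i, e ∈ F i := by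
  by_contra! huncov
  let U : Finset α := V.filter (D.Conn A (D.src e))
  have hU {f : β} (hf : f ∈ A) : D.src f ∈ U ↔ D.tgt f ∈ U := by
    simp only [U, mem_filter, hV f (hAI hf), true_and]
    exact ⟨fun h => h.trans (conn_of_mem hf), fun h => h.trans (conn_of_mem hf).symm⟩
  have hsrc : D.src e ∈ U := mem_filter.2 ⟨(hV e (hAI he)).1, Conn.refl _ _⟩
  have hlift (i : Fin m) {x y : α} (hxy : D.Conn A x y) : D.Conn (F i ∩ A) x y :=
    hxy.lift (D.equivalence_conn _) fun f hf =>
      conn_of_mem_closure_cycleMatroid ((hF.indep i).subset Set.inter_subset_left) (hA i hf)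
  have hconn (i : Fin m) : D.Connects (D.inside (F i) U) U := by
    intro x hx y hy
    have hxy := ((mem_filter.1 hx).2.symm.trans (mem_filter.1 hy).2)
    refine ((hlift i hxy).restrict (U := U) (fun f hf => hU hf.2) hx).mono fun f hf => ?_
    exact mem_coe.2 (mem_inside.2 ⟨hf.1.1, hf.2⟩)
  have heU : e ∈ D.inside I U := mem_inside.2 ⟨hAI he, hsrc, (hU he).1 hsrc⟩
  have hsum : ∑ i, #(D.inside (F i) U) ≤ #((D.inside I U).erase e) :=
    sum_card_le_card_of_pairwise_disjoint
      (fun i f hf => mem_erase.2 ⟨fun hfe => huncov i (hfe ▸ inside_subset hf),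
        inside_subset_inside (hF.subset i) hf⟩)
      fun i j hij => (hF.disjoint hij).mono inside_subset inside_subset
  have hcard : m * #U ≤ ∑ i, #(D.inside (F i) U) + m := by
    simpa [sum_add_distrib] using sum_le_sum fun i (_ : i ∈ univ) => (hconn i).card_le_card_add_one
  have hsparse := hI U ⟨_, hsrc⟩
  have := card_erase_add_one heU
  omega

/-- A form of the Nash-Williams--Tutte theorem. -/
theorem Sparse.exists_isConnectingPacking (hI : D.Sparse m I) (hV : D.EndsIn I V)
    (hcard : m * #V ≤ #I + m) : ∃ F : Fin m → Finset β, D.IsConnectingPacking I V F := by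
  obtain ⟨F, A, hF, hAI, huncov, hA⟩ := exists_indepPacking_spanning (M := D.cycleMatroid) (I := I)
    (Fin m) (Set.subset_univ _)
  rcases V.eq_empty_or_nonempty with rfl | hne
  · exact ⟨F, hF.subset, hF.disjoint, fun j x hx => absurd hx (notMem_empty x)⟩
  have hcover : I ⊆ univ.biUnion F := fun e he => by
    by_contra he'
    simp only [mem_biUnion, mem_univ, true_and, not_exists] at he'
    obtain ⟨i, hi⟩ := hI.exists_mem_of_spanning hV hF hAI hA (huncov e he he')
    exact he' i hi
  have hsum : #I ≤ ∑ j, #(F j) := (card_le_card hcover).trans card_biUnion_le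
  have hlt (j : Fin m) : #(F j) + 1 ≤ #V :=
    card_lt_of_indep (hF.indep j) (hV.mono (hF.subset j)) hne
  have hsum_eq : ∑ j, (#(F j) + 1) = ∑ _j : Fin m, #V := by
    refine (sum_le_sum fun j _ => hlt j).antisymm ?_
    simp only [sum_add_distrib, sum_const, card_univ, Fintype.card_fin, smul_eq_mul, mul_one]
    omega
  have heq := (sum_eq_sum_iff_of_le fun j _ => hlt j).1 hsum_eq
  exact ⟨F, hF.subset, hF.disjoint, fun j =>
    connects_of_indep (hF.indep j) (hV.mono (hF.subset j)) (heq j (mem_univ j)).ge⟩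

lemma Tight.exists_isConnectingPacking {X : Finset α} (hX : D.Tight m I X) (hI : D.Sparse m I) :
    ∃ F : Fin m → Finset β, D.IsConnectingPacking (D.inside I X) X F :=
  (hI.mono inside_subset).exists_isConnectingPacking endsIn_inside hX.2.ge

/-- The edges of `I` between different fibres of `p`. -/
noncomputable def crossing {ι : Type*} (D : EdgeEnds α β) (p : α → ι) (I : Finset β) : Finset β :=
  {e ∈ I | p (D.src e) ≠ p (D.tgt e)}

lemma mem_crossing {ι : Type*} {p : α → ι} {e : β} :
    e ∈ D.crossing p I ↔ e ∈ I ∧ p (D.src e) ≠ p (D.tgt e) := by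
  simp only [crossing, mem_filter]

lemma crossing_subset_crossing {ι : Type*} {p : α → ι} (h : I ⊆ J) :
    D.crossing p I ⊆ D.crossing p J :=
  filter_subset_filter _ h

lemma crossing_subset {ι : Type*} {p : α → ι} : D.crossing p I ⊆ I :=
  filter_subset _ _

/-- The easy direction of the Nash-Williams--Tutte theorem: every partition of `V` is crossed by
many edges. -/
lemma IsConnectingPacking.mul_card_image_le {ι : Type*} [DecidableEq ι]
    (hF : D.IsConnectingPacking I V F) (p : α → ι) : m * #(V.image p) ≤ #(D.crossing p I) + m := by
  have hconn (j : Fin m) : (D.map p).Connects (D.crossing p (F j)) (V.image p) := by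
    intro u hu v hv
    obtain ⟨x, hx, rfl⟩ := mem_image.1 hu
    obtain ⟨y, hy, rfl⟩ := mem_image.1 hv
    simpa [crossing] using (hF.connects j x hx y hy).map p
  have hsum : ∑ j, #(D.crossing p (F j)) ≤ #(D.crossing p I) :=
    sum_card_le_card_of_pairwise_disjoint (fun j => crossing_subset_crossing (hF.subset j))
      fun i j hij => (hF.disjoint hij).mono crossing_subset crossing_subset
  calc m * #(V.image p) = ∑ _j : Fin m, #(V.image p) := by simp
    _ ≤ ∑ j, (#(D.crossing p (F j)) + 1) :=
        sum_le_sum fun j _ => (hconn j).card_le_card_add_one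
    _ ≤ _ := by simpa [sum_add_distrib] using hsum

end Packing

section TightPartition

variable {α β : Type*} {D : EdgeEnds α β} {m : ℕ} {I : Finset β} {V X : Finset α} {x y : α}

/-- The largest tight subset of `V` that contains `x`. -/
noncomputable def part (D : EdgeEnds α β) (m : ℕ) (I : Finset β) (V : Finset α) (x : α) :
    Finset α :=
  (V.powerset.filter fun X => D.Tight m I X ∧ x ∈ X).sup id

/-- The maximal tight subsets of `V`. -/
noncomputable def parts (D : EdgeEnds α β) (m : ℕ) (I : Finset β) (V : Finset α) :
    Finset (Finset α) :=
  V.image (D.part m I V)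

lemma mem_parts : X ∈ D.parts m I V ↔ ∃ x ∈ V, D.part m I V x = X := mem_image

lemma Tight.subset_part (hX : D.Tight m I X) (hXV : X ⊆ V) (hx : x ∈ X) :
    X ⊆ D.part m I V x :=
  le_sup (f := id) (mem_filter.2 ⟨mem_powerset.2 hXV, hX, hx⟩)

lemma part_subset : D.part m I V x ⊆ V :=
  Finset.sup_le fun _ hX => mem_powerset.1 (mem_filter.1 hX).1

lemma subset_of_mem_parts (hX : X ∈ D.parts m I V) : X ⊆ V := by
  obtain ⟨x, -, rfl⟩ := mem_parts.1 hX
  exact part_subset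

namespace Sparse

lemma mem_part (hI : D.Sparse m I) (hx : x ∈ V) : x ∈ D.part m I V x :=
  (hI.tight_singleton x).subset_part (singleton_subset_iff.2 hx) (mem_singleton_self x)
    (mem_singleton_self x)

lemma tight_part (hI : D.Sparse m I) (hx : x ∈ V) : D.Tight m I (D.part m I V x) := by
  have hx_mem := hI.mem_part hx
  suffices D.part m I V x = ∅ ∨ (D.Tight m I (D.part m I V x) ∧ x ∈ D.part m I V x) from
    (this.resolve_left (ne_empty_of_mem hx_mem)).1
  refine sup_induction (p := fun T => T = ∅ ∨ (D.Tight m I T ∧ x ∈ T)) (Or.inl rfl) ?_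
    fun X hX => Or.inr (mem_filter.1 hX).2
  rintro X (rfl | ⟨hX, hxX⟩) Y (rfl | ⟨hY, hxY⟩)
  · exact Or.inl (union_empty _)
  · exact Or.inr (by rw [sup_eq_union, empty_union]; exact ⟨hY, hxY⟩)
  · exact Or.inr (by rw [sup_eq_union, union_empty]; exact ⟨hX, hxX⟩)
  · exact Or.inr ⟨hI.tight_union hX hY ⟨x, mem_inter.2 ⟨hxX, hxY⟩⟩, mem_union_left _ hxX⟩

lemma part_eq (hI : D.Sparse m I) (hx : x ∈ V) (hy : y ∈ D.part m I V x) :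
    D.part m I V y = D.part m I V x := by
  have hxy : D.part m I V x ⊆ D.part m I V y := (hI.tight_part hx).subset_part part_subset hy
  exact ((hI.tight_part (part_subset hy)).subset_part part_subset
    (hxy (hI.mem_part hx))).antisymm hxy

lemma part_eq_of_tight (hI : D.Sparse m I) (hX : D.Tight m I X) (hXV : X ⊆ V) (hx : x ∈ X)
    (hy : y ∈ X) : D.part m I V x = D.part m I V y :=
  hI.part_eq (hXV hy) (hX.subset_part hXV hy hx)

lemma part_eq_of_mem_parts (hI : D.Sparse m I) (hX : X ∈ D.parts m I V) (hx : x ∈ X) :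
    D.part m I V x = X := by
  obtain ⟨y, hy, rfl⟩ := mem_parts.1 hX
  exact hI.part_eq hy hx

lemma tight_of_mem_parts (hI : D.Sparse m I) (hX : X ∈ D.parts m I V) : D.Tight m I X := by
  obtain ⟨y, hy, rfl⟩ := mem_parts.1 hX
  exact hI.tight_part hy

lemma pairwiseDisjoint_parts (hI : D.Sparse m I) :
    (D.parts m I V : Set (Finset α)).PairwiseDisjoint id := fun _ hX _ hY h =>
  disjoint_left.2 fun _ hx hy =>
    h ((hI.part_eq_of_mem_parts hX hx).symm.trans (hI.part_eq_of_mem_parts hY hy))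

lemma biUnion_parts (hI : D.Sparse m I) : (D.parts m I V).biUnion id = V := by
  refine (biUnion_subset.2 fun X hX => ?_).antisymm fun x hx =>
    mem_biUnion.2 ⟨_, mem_parts.2 ⟨x, hx, rfl⟩, hI.mem_part hx⟩
  obtain ⟨x, -, rfl⟩ := mem_parts.1 hX
  exact part_subset

lemma filter_part_eq_inside_biUnion (hI : D.Sparse m I) {P : Finset (Finset α)}
    (hP : P ⊆ D.parts m I V) :
    {e ∈ D.inside I (P.biUnion id) | D.part m I V (D.src e) = D.part m I V (D.tgt e)} =
      P.biUnion (D.inside I) := by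
  ext e
  simp only [mem_filter, mem_inside, mem_biUnion, id]
  constructor
  · rintro ⟨⟨he, ⟨X, hX, hsrc⟩, ⟨Y, hY, htgt⟩⟩, heq⟩
    rw [hI.part_eq_of_mem_parts (hP hX) hsrc, hI.part_eq_of_mem_parts (hP hY) htgt] at heq
    exact ⟨X, hX, he, hsrc, heq ▸ htgt⟩
  · rintro ⟨X, hX, he, hsrc, htgt⟩
    exact ⟨⟨he, ⟨X, hX, hsrc⟩, ⟨X, hX, htgt⟩⟩, (hI.part_eq_of_mem_parts (hP hX) hsrc).trans
      (hI.part_eq_of_mem_parts (hP hX) htgt).symm⟩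

lemma card_biUnion_inside_add (hI : D.Sparse m I) {P : Finset (Finset α)}
    (hP : P ⊆ D.parts m I V) : #(P.biUnion (D.inside I)) + m * #P = m * #(P.biUnion id) := by
  have hdisj : (P : Set (Finset α)).PairwiseDisjoint id := hI.pairwiseDisjoint_parts.subset hP
  have hdisj_inside : (P : Set (Finset α)).PairwiseDisjoint (D.inside I) := fun X hX Y hY h =>
    disjoint_inside (hdisj hX hY h)
  rw [card_biUnion hdisj_inside, card_biUnion hdisj, mul_sum, mul_comm m, ← smul_eq_mul,
    ← sum_const, ← sum_add_distrib]
  exact sum_congr rfl fun X hX => (hI.tight_of_mem_parts (hP hX)).2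

lemma card_inside_biUnion_add (hI : D.Sparse m I) {P : Finset (Finset α)}
    (hP : P ⊆ D.parts m I V) :
    #(D.inside I (P.biUnion id)) + m * #P =
      m * #(P.biUnion id) + #(D.crossing (D.part m I V) (D.inside I (P.biUnion id))) := by
  have hsplit := card_filter_add_card_filter_not (s := D.inside I (P.biUnion id))
    fun e => D.part m I V (D.src e) = D.part m I V (D.tgt e)
  rw [hI.filter_part_eq_inside_biUnion hP] at hsplit
  have hparts := hI.card_biUnion_inside_add hP
  simp only [crossing, ne_eq]
  omega

end Sparse

end TightPartition

section SparseBasis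

variable {α β : Type*} {D : EdgeEnds α β} {m : ℕ} {I E : Finset β} {V Y : Finset α} {e : β}
  {x : α}

/-- A maximal sparse subset `I` of `E`. Maximality is expressed by the obstacles to adding an edge:
its ends are in a common tight set. -/
structure IsSparseBasis (D : EdgeEnds α β) (m : ℕ) (V : Finset α) (E I : Finset β) : Prop where
  subset : I ⊆ E
  sparse : D.Sparse m I
  exists_tight : ∀ e ∈ E, e ∉ I → ∃ X ⊆ V, D.Tight m I X ∧ D.src e ∈ X ∧ D.tgt e ∈ X

lemma Sparse.exists_tight_of_not_sparse_insert (hI : D.Sparse m I)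
    (he : ¬ D.Sparse m (insert e I)) : ∃ X, D.Tight m I X ∧ D.src e ∈ X ∧ D.tgt e ∈ X := by
  simp only [Sparse, not_forall, not_le] at he
  obtain ⟨X, hX, hlt⟩ := he
  have hle := hI X hX
  by_cases heX : D.src e ∈ X ∧ D.tgt e ∈ X
  · have hinsert : #(D.inside (insert e I) X) ≤ #(D.inside I X) + 1 := by
      rw [inside, filter_insert, if_pos heX]
      exact card_insert_le _ _
    exact ⟨X, ⟨hX, by omega⟩, heX⟩
  · rw [inside, filter_insert, if_neg heX] at hlt
    exact absurd hle hlt.not_ge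

lemma exists_isSparseBasis (m : ℕ) (hE : D.EndsIn E V) : ∃ I, D.IsSparseBasis m V E I := by
  obtain ⟨I, hI, hmax⟩ := (E.powerset.filter fun I => D.Sparse m I).exists_maximal
    ⟨∅, mem_filter.2 ⟨empty_mem_powerset E, sparse_empty⟩⟩
  obtain ⟨hIE, hsparse⟩ := mem_filter.1 hI
  rw [mem_powerset] at hIE
  refine ⟨I, hIE, hsparse, fun e he heI => ?_⟩
  have hns : ¬ D.Sparse m (insert e I) := fun hs => heI
    (hmax (mem_filter.2 ⟨mem_powerset.2 (insert_subset he hIE), hs⟩) (subset_insert e I)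
      (mem_insert_self e I))
  obtain ⟨X, hX, hsrc, htgt⟩ := hsparse.exists_tight_of_not_sparse_insert hns
  have hsrcV := mem_inter.2 ⟨hsrc, (hE e he).1⟩
  exact ⟨X ∩ V, inter_subset_right, hsparse.tight_inter_of_endsIn (hE.mono hIE) hX ⟨_, hsrcV⟩,
    hsrcV, mem_inter.2 ⟨htgt, (hE e he).2⟩⟩

namespace IsSparseBasis

lemma crossing_eq (hI : D.IsSparseBasis m V E I) :
    D.crossing (D.part m I V) E = D.crossing (D.part m I V) I := by
  ext e
  simp only [mem_crossing, and_congr_left_iff]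
  refine fun hne => ⟨fun he => ?_, fun he => hI.subset he⟩
  by_contra heI
  obtain ⟨X, hXV, hX, hsrc, htgt⟩ := hI.exists_tight e he heI
  exact hne (hI.sparse.part_eq_of_tight hX hXV hsrc htgt)

lemma card_add (hI : D.IsSparseBasis m V E I) (hE : D.EndsIn E V) :
    #I + m * #(D.parts m I V) = m * #V + #(D.crossing (D.part m I V) E) := by
  have hcard := hI.sparse.card_inside_biUnion_add (subset_refl (D.parts m I V))
  rwa [hI.sparse.biUnion_parts, (hE.mono hI.subset).inside_eq, ← hI.crossing_eq] at hcard

lemma subset_part_of_isConnectingPacking (hI : D.IsSparseBasis m V E I) (hYV : Y ⊆ V)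
    {F : Fin m → Finset β} (hF : D.IsConnectingPacking (D.inside E Y) Y F) (hx : x ∈ Y) :
    Y ⊆ D.part m I V x := by
  let P := Y.image (D.part m I V)
  have hP : P ⊆ D.parts m I V := image_subset_image hYV
  have hYP : Y ⊆ P.biUnion id := fun y hy =>
    mem_biUnion.2 ⟨_, mem_image_of_mem _ hy, hI.sparse.mem_part (hYV hy)⟩
  have hPV : P.biUnion id ⊆ V := (biUnion_subset_biUnion_of_subset_left _ hP).trans
    hI.sparse.biUnion_parts.subset
  have hcross : D.crossing (D.part m I V) (D.inside E Y) ⊆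
      D.crossing (D.part m I V) (D.inside I (P.biUnion id)) := by
    intro e he
    obtain ⟨heE, hne⟩ := mem_crossing.1 he
    have heI : e ∈ D.crossing (D.part m I V) I := by
      rw [← hI.crossing_eq]
      exact mem_crossing.2 ⟨inside_subset heE, hne⟩
    exact mem_crossing.2 ⟨mem_inside.2 ⟨(mem_crossing.1 heI).1, hYP (mem_inside.1 heE).2.1,
      hYP (mem_inside.1 heE).2.2⟩, hne⟩
  have hmany : m * #P ≤ #(D.crossing (D.part m I V) (D.inside E Y)) + m :=
    hF.mul_card_image_le (D.part m I V)
  have hcard_cross := card_le_card hcross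
  have hcard := hI.sparse.card_inside_biUnion_add hP
  have hne : (P.biUnion id).Nonempty := ⟨x, hYP hx⟩
  have hsparse := hI.sparse _ hne
  have htight : D.Tight m I (P.biUnion id) := ⟨hne, by omega⟩
  exact hYP.trans (htight.subset_part hPV (hYP hx))

end IsSparseBasis

end SparseBasis

section Graph

variable {α β : Type*} {D : EdgeEnds α β} {G H : Graph α β} {V : Finset α} {E I : Finset β}
  {m : ℕ} {x y : α} {e : β}

/-- `D` gives the two ends of every edge of `G`. -/
def IsEndsOf (D : EdgeEnds α β) (G : Graph α β) : Prop :=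
  ∀ ⦃e⦄, e ∈ E(G) → G.IsLink e (D.src e) (D.tgt e)

lemma exists_isEndsOf (hV : V(G).Nonempty) : ∃ D : EdgeEnds α β, D.IsEndsOf G := by
  obtain ⟨v, -⟩ := hV
  have (e : β) : ∃ x y, e ∈ E(G) → G.IsLink e x y := by
    by_cases he : e ∈ E(G)
    · obtain ⟨x, y, h⟩ := exists_isLink_of_mem_edgeSet he
      exact ⟨x, y, fun _ => h⟩
    · exact ⟨v, v, fun h => absurd h he⟩
  choose s t hst using this
  exact ⟨⟨s, t⟩, hst⟩

lemma reachable_symm (h : G.Reachable x y) : G.Reachable y x := by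
  induction h with
  | refl => exact Relation.ReflTransGen.refl
  | tail _ hadj ih => exact Relation.ReflTransGen.head hadj.symm ih

lemma equivalence_reachable (G : Graph α β) : Equivalence G.Reachable :=
  ⟨fun _ => Relation.ReflTransGen.refl, reachable_symm, Relation.ReflTransGen.trans⟩

namespace IsEndsOf

lemma of_le (h : D.IsEndsOf G) (hH : H ≤ G) : D.IsEndsOf H := fun _ he =>
  (hH.isLink_iff he).2 (h (hH.edgeSet_mono he))

lemma eq_or_eq (h : D.IsEndsOf G) (he : G.IsLink e x y) :
    (D.src e = x ∧ D.tgt e = y) ∨ (D.src e = y ∧ D.tgt e = x) :=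
  (h he.edge_mem).eq_and_eq_or_eq_and_eq he

lemma conn_of_isLink (h : D.IsEndsOf G) {F : Set β} (he : G.IsLink e x y) (heF : e ∈ F) :
    D.Conn F x y := by
  rcases h.eq_or_eq he with ⟨rfl, rfl⟩ | ⟨rfl, rfl⟩
  · exact conn_of_mem heF
  · exact (conn_of_mem heF).symm

lemma reachable_iff (h : D.IsEndsOf G) : G.Reachable x y ↔ D.Conn E(G) x y := by
  refine ⟨fun hr => ?_, Conn.lift (equivalence_reachable G)
    fun e he => Relation.ReflTransGen.single ⟨e, h he⟩⟩
  induction hr with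
  | refl => exact Conn.refl _ _
  | tail _ hadj ih =>
    obtain ⟨e, he⟩ := hadj
    exact ih.trans (h.conn_of_isLink he he.edge_mem)

lemma connected_restrict (h : D.IsEndsOf G) (hV : V(G) = V) (hne : V.Nonempty) {F : Set β}
    (hF : F ⊆ E(G)) (hc : D.Connects F V) : (G.restrict F).Connected := by
  refine ⟨by simpa [hV] using hne, fun x hx y hy => ?_⟩
  rw [vertexSet_restrict, hV] at hx hy
  rw [(h.of_le restrict_le).reachable_iff, edgeSet_restrict, Set.inter_eq_right.2 hF]
  exact hc x hx y hy

lemma isAcyclic_of_minimal (h : D.IsEndsOf G) (hc : G.Connected)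
    (hmin : ∀ e ∈ E(G), ¬ (G.deleteEdges {e}).Connected) : G.IsAcyclic := by
  intro e x y he hr
  have hdel := h.of_le (deleteEdges_le (F := {e}))
  refine hmin e he.edge_mem ⟨hc.1, fun u hu v hv => ?_⟩
  refine (h.reachable_iff.1 (hc.2 u hu v hv)).lift (equivalence_reachable _) fun f hf => ?_
  rw [hdel.reachable_iff] at hr ⊢
  by_cases hfe : f = e
  · subst hfe
    rcases h.eq_or_eq he with ⟨rfl, rfl⟩ | ⟨rfl, rfl⟩
    exacts [hr, hr.symm]
  · exact conn_of_mem (by simp [hf, hfe])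

lemma exists_isTree (h : D.IsEndsOf G) (F : Finset β) (hc : (G.restrict (F : Set β)).Connected) :
    ∃ F' ⊆ F, (G.restrict (F' : Set β)).IsTree := by
  obtain ⟨F', hF', hmin⟩ := exists_minimal_le_of_wellFoundedLT
    (fun F : Finset β => (G.restrict (F : Set β)).Connected) F hc
  refine ⟨F', hF', hmin.prop, (h.of_le restrict_le).isAcyclic_of_minimal hmin.prop ?_⟩
  intro e he hdel
  have heq : (G.restrict (F' : Set β)).deleteEdges {e} =
      G.restrict ((F'.erase e : Finset β) : Set β) := by
    refine Graph.ext rfl fun f x y => ?_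
    simp only [deleteEdges_isLink, restrict_isLink, coe_erase, Set.mem_sdiff, mem_coe]
    tauto
  rw [heq] at hdel
  exact (notMem_erase e F') (hmin.2 hdel (erase_subset e F') he.2)

lemma isTreeConnected (h : D.IsEndsOf G) (hV : V(G) = V) (hne : V.Nonempty)
    (hI : (I : Set β) ⊆ E(G)) {F : Fin m → Finset β} (hF : D.IsConnectingPacking I V F) :
    IsTreeConnected m G := by
  have htree (j : Fin m) : ∃ F' ⊆ F j, (G.restrict (F' : Set β)).IsTree :=
    h.exists_isTree (F j) (h.connected_restrict hV hne
      ((coe_subset.2 (hF.subset j)).trans hI) (hF.connects j))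
  choose F' hF' hT using htree
  refine ⟨fun j => G.restrict (F' j : Set β), fun j => ⟨⟨restrict_le, rfl⟩, hT j⟩, ?_⟩
  intro i j hij
  exact (disjoint_coe.2 ((hF.disjoint hij).mono (hF' i) (hF' j))).mono Set.inter_subset_right
    Set.inter_subset_right

lemma exists_isConnectingPacking (h : D.IsEndsOf G) (hV : V(G) = V) (hE : E(G) = E)
    (ht : IsTreeConnected m G) : ∃ F : Fin m → Finset β, D.IsConnectingPacking E V F := by
  obtain ⟨T, hT, hdisj⟩ := ht
  have hsub (j : Fin m) : E(T j) ⊆ (E : Set β) := hE ▸ (hT j).1.le.edgeSet_mono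
  choose F hF using fun j => (E.finite_toSet.subset (hsub j)).exists_finset_coe
  refine ⟨F, fun j => ?_, fun i j hij => ?_, fun j x hx y hy => ?_⟩
  · exact coe_subset.1 (hF j ▸ hsub j)
  · exact disjoint_coe.1 (by simpa only [hF] using hdisj hij)
  · have hVT : V(T j) = V := (hT j).1.vertexSet_eq.trans hV
    rw [hF, ← (h.of_le (hT j).1.le).reachable_iff]
    exact (hT j).2.1.2 x (hVT ▸ hx) y (hVT ▸ hy)

lemma edgeSet_induce (h : D.IsEndsOf G) (hE : E(G) = E) (Y : Finset α) :
    E(G.induce (Y : Set α)) = D.inside E Y := by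
  ext e
  simp only [Graph.edgeSet_induce, Set.mem_ofPred_eq, mem_coe, mem_inside, ← mem_coe (s := E),
    ← hE]
  constructor
  · rintro ⟨x, y, he, hx, hy⟩
    rcases h.eq_or_eq he with ⟨rfl, rfl⟩ | ⟨rfl, rfl⟩
    exacts [⟨he.edge_mem, hx, hy⟩, ⟨he.edge_mem, hy, hx⟩]
  · rintro ⟨he, hx, hy⟩
    exact ⟨_, _, h he, hx, hy⟩

end IsEndsOf

lemma nonempty_of_isTreeConnected (hm : 1 ≤ m) (h : IsTreeConnected m G) : V(G).Nonempty := by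
  obtain ⟨T, hT, -⟩ := h
  exact (hT ⟨0, hm⟩).2.1.1.mono (hT ⟨0, hm⟩).1.le.vertexSet_mono

/-- `G` is a finite graph with vertex set `V` and edge set `E`, and `D` gives the ends of its
edges. -/
structure Represents (D : EdgeEnds α β) (G : Graph α β) (V : Finset α) (E : Finset β) : Prop where
  isEndsOf : D.IsEndsOf G
  vertexSet_eq : V(G) = V
  edgeSet_eq : E(G) = E

namespace Represents

lemma endsIn (h : D.Represents G V E) : D.EndsIn E V := fun e he => by
  have hlink := h.isEndsOf (e := e) (by simpa [h.edgeSet_eq] using he)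
  rw [← mem_coe, ← mem_coe (s := V), ← h.vertexSet_eq]
  exact ⟨hlink.left_mem, hlink.right_mem⟩

lemma mem_of_isLink (h : D.Represents G V E) (he : G.IsLink e x y) : e ∈ E := by
  rw [← mem_coe, ← h.edgeSet_eq]
  exact he.edge_mem

lemma isLink (h : D.Represents G V E) (he : e ∈ E) : G.IsLink e (D.src e) (D.tgt e) :=
  h.isEndsOf (h.edgeSet_eq ▸ mem_coe.2 he)

lemma induce_le_of_subset (h : D.Represents G V E) {Y : Finset α} (hY : Y ⊆ V) :
    G.induce (Y : Set α) ≤ G :=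
  induce_le (h.vertexSet_eq ▸ coe_subset.2 hY)

lemma isTreeConnected_induce_of_tight (h : D.Represents G V E) (hI : D.Sparse m I) (hIE : I ⊆ E)
    {X : Finset α} (hXV : X ⊆ V) (hX : D.Tight m I X) :
    IsTreeConnected m (G.induce (X : Set α)) := by
  obtain ⟨F, hF⟩ := hX.exists_isConnectingPacking hI
  refine (h.isEndsOf.of_le (h.induce_le_of_subset hXV)).isTreeConnected rfl hX.1 ?_ hF
  rw [h.isEndsOf.edgeSet_induce h.edgeSet_eq]
  exact coe_subset.2 (inside_subset_inside hIE)

lemma subset_part_of_isTreeConnected_induce (h : D.Represents G V E)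
    (hI : D.IsSparseBasis m V E I) {Y : Finset α} (hY : Y ⊆ V)
    (ht : IsTreeConnected m (G.induce (Y : Set α))) (hx : x ∈ Y) : Y ⊆ D.part m I V x := by
  obtain ⟨F, hF⟩ := (h.isEndsOf.of_le (h.induce_le_of_subset hY)).exists_isConnectingPacking rfl
    (h.isEndsOf.edgeSet_induce h.edgeSet_eq Y) ht
  exact hI.subset_part_of_isConnectingPacking hY hF hx

lemma treeComponentSets_eq (h : D.Represents G V E) (hI : D.IsSparseBasis m V E I) (hm : 1 ≤ m) :
    treeComponentSets m G = ((↑) : Finset α → Set α) '' (D.parts m I V) := by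
  have hpart {x : α} (hx : x ∈ V) : (D.part m I V x : Set α) ⊆ V(G) ∧
      IsTreeConnected m (G.induce (D.part m I V x : Set α)) :=
    ⟨h.vertexSet_eq ▸ coe_subset.2 part_subset,
      h.isTreeConnected_induce_of_tight hI.sparse hI.subset part_subset (hI.sparse.tight_part hx)⟩
  have hsub {Y : Set α} (hY : Y ⊆ V(G)) (ht : IsTreeConnected m (G.induce Y)) {x : α}
      (hx : x ∈ Y) : Y ⊆ D.part m I V x := by
    rw [h.vertexSet_eq] at hY
    lift Y to Finset α using V.finite_toSet.subset hY
    exact coe_subset.2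
      (h.subset_part_of_isTreeConnected_induce hI (coe_subset.1 hY) ht (mem_coe.1 hx))
  ext Y
  simp only [treeComponentSets, Set.mem_ofPred_eq, Set.mem_image, mem_coe]
  constructor
  · intro hY
    obtain ⟨x, hx⟩ : Y.Nonempty := nonempty_of_isTreeConnected hm hY.1.2
    have hxV : x ∈ V := mem_coe.1 (h.vertexSet_eq ▸ hY.1.1 hx)
    have hYpart := hsub hY.1.1 hY.1.2 hx
    exact ⟨_, mem_parts.2 ⟨x, hxV, rfl⟩, (hY.2 (hpart hxV) hYpart).antisymm hYpart⟩
  · rintro ⟨X, hX, rfl⟩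
    obtain ⟨x, hx, rfl⟩ := mem_parts.1 hX
    exact ⟨hpart hx, fun Y hY hle => hsub hY.1 hY.2 (hle (hI.sparse.mem_part hx))⟩

lemma crossingEdges_eq (h : D.Represents G V E) (hI : D.IsSparseBasis m V E I) (hm : 1 ≤ m) :
    G.crossingEdges (treeComponentSets m G) = D.crossing (D.part m I V) E := by
  ext e
  rw [h.treeComponentSets_eq hI hm, mem_coe, mem_crossing]
  simp only [crossingEdges, Set.mem_image, mem_coe, Set.mem_ofPred_eq,
    exists_exists_and_eq_and, ne_eq, coe_inj]
  constructor
  · rintro ⟨x, y, he, A, hA, B, hB, hAB, hx, hy⟩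
    rw [← hI.sparse.part_eq_of_mem_parts hA hx, ← hI.sparse.part_eq_of_mem_parts hB hy] at hAB
    rcases h.isEndsOf.eq_or_eq he with ⟨rfl, rfl⟩ | ⟨rfl, rfl⟩
    exacts [⟨h.mem_of_isLink he, hAB⟩, ⟨h.mem_of_isLink he, Ne.symm hAB⟩]
  · rintro ⟨he, hne⟩
    obtain ⟨hsrc, htgt⟩ := h.endsIn e he
    exact ⟨_, _, h.isLink he, _, mem_parts.2 ⟨_, hsrc, rfl⟩, _, mem_parts.2 ⟨_, htgt, rfl⟩, hne,
      hI.sparse.mem_part hsrc, hI.sparse.mem_part htgt⟩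

lemma mul_Omega (h : D.Represents G V E) (hI : D.IsSparseBasis m V E I) (hm : 1 ≤ m) :
    (m : ℝ) * Omega m G = m * #V - #I := by
  have hm' : (m : ℝ) ≠ 0 := by positivity
  have hcard : (#I : ℝ) + m * #(D.parts m I V) = m * #V + #(D.crossing (D.part m I V) E) :=
    mod_cast hI.card_add h.endsIn
  rw [Omega, h.crossingEdges_eq hI hm, h.treeComponentSets_eq hI hm, Set.ncard_coe_finset,
    Set.ncard_image_of_injective _ coe_injective, Set.ncard_coe_finset]
  field_simp
  linarith

end Represents

end Graph

section Degree

variable {α β : Type*} {D : EdgeEnds α β} {H K : Finset β} {V : Finset α} {v : α} {e f : β}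

/-- The number of edges of `H` incident to `v`; a loop is counted once. -/
noncomputable def deg (D : EdgeEnds α β) (H : Finset β) (v : α) : ℕ :=
  #{e ∈ H | D.src e = v ∨ D.tgt e = v}

lemma deg_congr (h : ∀ e, D.src e = v ∨ D.tgt e = v → (e ∈ K ↔ e ∈ H)) :
    D.deg K v = D.deg H v := by
  unfold deg
  congr 1
  ext e
  simp only [mem_filter, and_congr_left_iff]
  exact h e

lemma sum_deg_add_card_inside_sdiff (hloop : ∀ e ∈ H, D.src e ≠ D.tgt e) (hV : D.EndsIn H V)
    (S : Finset α) :
    ∑ v ∈ S, D.deg H v + #(D.inside H (V \ S)) = #H + #(D.inside H S) := by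
  have hdouble : ∑ v ∈ S, D.deg H v = ∑ e ∈ H, #{v ∈ S | D.src e = v ∨ D.tgt e = v} :=
    sum_card_bipartiteAbove_eq_sum_card_bipartiteBelow _
  rw [hdouble, inside, inside, card_filter, card_filter, card_eq_sum_ones, ← sum_add_distrib,
    ← sum_add_distrib]
  refine sum_congr rfl fun e he => ?_
  rw [filter_or, filter_eq, filter_eq]
  by_cases hsrc : D.src e ∈ S <;> by_cases htgt : D.tgt e ∈ S <;>
    simp [hsrc, htgt, hV e he, hloop e he]

lemma sum_deg_eq_two_mul_card (hloop : ∀ e ∈ H, D.src e ≠ D.tgt e) (hV : D.EndsIn H V) :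
    ∑ v ∈ V, D.deg H v = 2 * #H := by
  have hsum := sum_deg_add_card_inside_sdiff hloop hV V
  rw [sdiff_self, hV.inside_eq, ← two_mul] at hsum
  simpa [inside] using hsum

lemma deg_exchange_le_add_one : D.deg (insert e (H.erase f)) v ≤ D.deg H v + 1 := by
  refine (card_le_card fun g => ?_).trans (card_insert_le e _)
  simp only [mem_filter, mem_insert, mem_erase]
  tauto

lemma filter_exchange_subset (he : ¬ (D.src e = v ∨ D.tgt e = v)) :
    {g ∈ insert e (H.erase f) | D.src g = v ∨ D.tgt g = v} ⊆
      ({g ∈ H | D.src g = v ∨ D.tgt g = v} : Finset β).erase f := by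
  intro g
  simp only [mem_filter, mem_insert, mem_erase]
  rintro ⟨rfl | h, h'⟩
  exacts [absurd h' he, ⟨h.1, h.2, h'⟩]

lemma deg_exchange_le (he : ¬ (D.src e = v ∨ D.tgt e = v)) :
    D.deg (insert e (H.erase f)) v ≤ D.deg H v :=
  card_le_card ((filter_exchange_subset he).trans (erase_subset _ _))

lemma deg_exchange_lt (he : ¬ (D.src e = v ∨ D.tgt e = v)) (hf : f ∈ H)
    (hfv : D.src f = v ∨ D.tgt f = v) : D.deg (insert e (H.erase f)) v < D.deg H v :=
  (card_le_card (filter_exchange_subset he)).trans_lt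
    (card_erase_lt_of_mem (mem_filter.2 ⟨hf, hfv⟩))

/-- The total amount by which the degrees exceed `η`. -/
noncomputable def excess (D : EdgeEnds α β) (η : ℕ) (V : Finset α) (H : Finset β) : ℕ :=
  ∑ v ∈ V, (D.deg H v - η)

lemma excess_lt_excess {η : ℕ} (hle : ∀ w, D.deg K w ≤ max η (D.deg H w)) (hv : v ∈ V)
    (hvη : η < D.deg H v) (hlt : D.deg K v < D.deg H v) :
    D.excess η V K < D.excess η V H := by
  refine sum_lt_sum (fun w _ => ?_) ⟨v, hv, by omega⟩
  have := hle w
  omega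

end Degree

section Exchange

variable {α β : Type*} {D : EdgeEnds α β} {m : ℕ} {E H K K₁ K₂ : Finset β}
  {V X Y Z Q : Finset α} {u v x y : α} {e f : β}

/-- A sparse subset of `E` with `m (|V| - 1)` edges: when all edges of `E` have their ends in `V`,
an edge set that decomposes into `m` spanning trees. -/
structure IsBase (D : EdgeEnds α β) (m : ℕ) (E : Finset β) (V : Finset α) (H : Finset β) :
    Prop where
  subset : H ⊆ E
  sparse : D.Sparse m H
  card_add : #H + m = m * #V

lemma IsBase.card_eq (hK : D.IsBase m E V K) (hH : D.IsBase m E V H) : #K = #H :=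
  Nat.add_right_cancel (hK.card_add.trans hH.card_add.symm)

lemma IsBase.tight (hH : D.IsBase m E V H) (hE : D.EndsIn E V) (hV : V.Nonempty) :
    D.Tight m H V :=
  ⟨hV, by rw [(hE.mono hH.subset).inside_eq, hH.card_add]⟩

/-- `K` and `H` have the same edges, except possibly for edges with both ends in `X`. -/
def AgreeOff (D : EdgeEnds α β) (X : Finset α) (K H : Finset β) : Prop :=
  ∀ e, ¬ (D.src e ∈ X ∧ D.tgt e ∈ X) → (e ∈ K ↔ e ∈ H)

lemma card_inside_add_card_filter_not (H : Finset β) (X : Finset α) :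
    #(D.inside H X) + #{e ∈ H | ¬ (D.src e ∈ X ∧ D.tgt e ∈ X)} = #H :=
  card_filter_add_card_filter_not _

namespace AgreeOff

lemma mono (h : D.AgreeOff X K H) (hXY : X ⊆ Y) : D.AgreeOff Y K H := fun e he =>
  h e fun h' => he ⟨hXY h'.1, hXY h'.2⟩

lemma card_inside_eq (h : D.AgreeOff X K H) (hcard : #K = #H) :
    #(D.inside K X) = #(D.inside H X) := by
  have hK := card_inside_add_card_filter_not (D := D) K X
  have hH := card_inside_add_card_filter_not (D := D) H X
  have hfilter : ({e ∈ K | ¬ (D.src e ∈ X ∧ D.tgt e ∈ X)} : Finset β) =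
      {e ∈ H | ¬ (D.src e ∈ X ∧ D.tgt e ∈ X)} := by
    ext e
    simp only [mem_filter, and_congr_left_iff]
    exact h e
  rw [hfilter] at hK
  omega

lemma tight_iff (h : D.AgreeOff X K H) (hcard : #K = #H) (hXZ : X ⊆ Z) :
    D.Tight m K Z ↔ D.Tight m H Z := by
  rw [Tight, Tight, (h.mono hXZ).card_inside_eq hcard]

lemma inside_eq_of_disjoint (h : D.AgreeOff X K H) (hXY : Disjoint X Y) :
    D.inside K Y = D.inside H Y := by
  ext e
  simp only [mem_inside, and_congr_left_iff]
  exact fun he => h e fun he' => disjoint_left.1 hXY he'.1 he.1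

lemma mem_iff_of_incident (h : D.AgreeOff X K H) (hv : v ∉ X)
    (he : D.src e = v ∨ D.tgt e = v) : e ∈ K ↔ e ∈ H :=
  h e fun he' => by rcases he with rfl | rfl; exacts [hv he'.1, hv he'.2]

lemma deg_eq (h : D.AgreeOff X K H) (hv : v ∉ X) : D.deg K v = D.deg H v :=
  deg_congr fun _ => h.mem_iff_of_incident hv

lemma exchange (h : D.AgreeOff X K H) (hQX : Q ⊆ X) (hsrc : D.src e ∈ X) (htgt : D.tgt e ∈ X)
    (hf : f ∈ D.inside K Q) : D.AgreeOff X (insert e (K.erase f)) H := by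
  intro g hg
  have hge : g ≠ e := by rintro rfl; exact hg ⟨hsrc, htgt⟩
  have hgf : g ≠ f := by
    rintro rfl
    exact hg ((mem_inside.1 hf).2.imp (hQX ·) (hQX ·))
  simp [hge, hgf, h g hg]

end AgreeOff

/-- The edge set that equals `K₂` inside `Y` and `K₁` elsewhere. -/
noncomputable def swap (D : EdgeEnds α β) (K₁ K₂ : Finset β) (Y : Finset α) : Finset β :=
  {e ∈ K₁ | ¬ (D.src e ∈ Y ∧ D.tgt e ∈ Y)} ∪ D.inside K₂ Y

lemma disjoint_filter_not_inside :
    Disjoint {e ∈ K₁ | ¬ (D.src e ∈ Y ∧ D.tgt e ∈ Y)} (D.inside K₂ Y) := by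
  rw [Finset.disjoint_left]
  intro e he he'
  exact (mem_filter.1 he).2 (mem_inside.1 he').2

lemma inside_swap : D.inside (D.swap K₁ K₂ Y) Y = D.inside K₂ Y := by
  ext e
  simp only [swap, mem_inside, mem_union, mem_filter]
  tauto

lemma agreeOff_swap : D.AgreeOff Y (D.swap K₁ K₂ Y) K₁ := fun e he => by
  simp only [swap, mem_inside, mem_union, mem_filter]
  tauto

lemma Sparse.swap (h₁ : D.Sparse m K₁) (h₂ : D.Sparse m K₂) (hY : D.Tight m K₁ Y) :
    D.Sparse m (D.swap K₁ K₂ Y) := by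
  intro Z hZ
  let R : Finset β := {e ∈ D.inside K₁ Z | ¬ (D.src e ∈ Y ∧ D.tgt e ∈ Y)}
  have hsplit : #(D.inside (D.swap K₁ K₂ Y) Z) ≤ #R + #(D.inside K₂ (Z ∩ Y)) := by
    refine (card_le_card fun e he => ?_).trans (card_union_le _ _)
    simp only [R, EdgeEnds.swap, mem_inside, mem_union, mem_filter, mem_inter] at he ⊢
    tauto
  rcases (Z ∩ Y).eq_empty_or_nonempty with hempty | hne
  · have hzero : #(D.inside K₂ (Z ∩ Y)) = 0 := by simp [hempty, inside]
    have hR : #R ≤ #(D.inside K₁ Z) := card_filter_le _ _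
    have hZ_le := h₁ Z hZ
    omega
  · have hR : #R + #(D.inside K₁ Y) ≤ #(D.inside K₁ (Z ∪ Y)) := by
      rw [← card_union_of_disjoint disjoint_filter_not_inside]
      exact card_le_card (union_subset ((filter_subset _ _).trans
        (inside_mono subset_union_left)) (inside_mono subset_union_right))
    have hinter_le := h₂ _ hne
    have hunion_le := h₁ _ (hZ.mono (subset_union_left (s₂ := Y)))
    have hcard := mul_card_union_add_mul_card_inter m Z Y
    have hYeq := hY.2
    omega

lemma IsBase.swap (h₁ : D.IsBase m E V K₁) (h₂ : D.IsBase m E V K₂) (hY₁ : D.Tight m K₁ Y)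
    (hY₂ : D.Tight m K₂ Y) : D.IsBase m E V (D.swap K₁ K₂ Y) where
  subset := union_subset ((filter_subset _ _).trans h₁.subset) (inside_subset.trans h₂.subset)
  sparse := h₁.sparse.swap h₂.sparse hY₁
  card_add := by
    have hcard := card_inside_add_card_filter_not (D := D) K₁ Y
    have hY₁eq := hY₁.2
    have hY₂eq := hY₂.2
    rw [EdgeEnds.swap, card_union_of_disjoint disjoint_filter_not_inside, ← h₁.card_add]
    omega

lemma Sparse.exists_minimal_tight (hH : D.Sparse m H) (hV : D.Tight m H V) (hx : x ∈ V)
    (hy : y ∈ V) :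
    ∃ Q, D.Tight m H Q ∧ x ∈ Q ∧ y ∈ Q ∧ ∀ X, D.Tight m H X → x ∈ X → y ∈ X → Q ⊆ X := by
  obtain ⟨Q, -, hQ⟩ := exists_minimal_le_of_wellFoundedLT
    (fun X => D.Tight m H X ∧ x ∈ X ∧ y ∈ X) V ⟨hV, hx, hy⟩
  obtain ⟨hQt, hxQ, hyQ⟩ := hQ.prop
  refine ⟨Q, hQt, hxQ, hyQ, fun X hX hxX hyX => ?_⟩
  have hxQX := mem_inter.2 ⟨hxQ, hxX⟩
  exact (hQ.2 ⟨(hH.tight_union_inter hQt hX ⟨x, hxQX⟩).2, hxQX, mem_inter.2 ⟨hyQ, hyX⟩⟩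
    inter_subset_left).trans inter_subset_right

/-- An edge `e` can be exchanged for any edge inside the smallest tight set that contains the
ends of `e`. -/
lemma Sparse.exchange (hH : D.Sparse m H)
    (hmin : ∀ X, D.Tight m H X → D.src e ∈ X → D.tgt e ∈ X → Q ⊆ X) (hf : f ∈ D.inside H Q) :
    D.Sparse m (insert e (H.erase f)) := by
  intro X hX
  have hle := hH X hX
  have hsub : D.inside (insert e (H.erase f)) X ⊆ insert e ((D.inside H X).erase f) := by
    intro g
    simp only [mem_inside, mem_insert, mem_erase]
    tauto
  by_cases heX : D.src e ∈ X ∧ D.tgt e ∈ X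
  · have hcard := (card_le_card hsub).trans (card_insert_le _ _)
    by_cases ht : D.Tight m H X
    · have := card_erase_add_one (inside_mono (hmin X ht heX.1 heX.2) hf)
      omega
    · have hne : #(D.inside H X) + m ≠ m * #X := fun h => ht ⟨hX, h⟩
      have := card_erase_le (s := D.inside H X) (a := f)
      omega
  · have hsub' : D.inside (insert e (H.erase f)) X ⊆ D.inside H X := by
      refine fun g hg => mem_of_mem_erase ((mem_insert.1 (hsub hg)).resolve_left ?_)
      rintro rfl
      exact heX (mem_inside.1 hg).2
    exact (Nat.add_le_add_right (card_le_card hsub') m).trans hle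

lemma IsBase.exchange (hH : D.IsBase m E V H) (he : e ∈ E) (heH : e ∉ H)
    (hmin : ∀ X, D.Tight m H X → D.src e ∈ X → D.tgt e ∈ X → Q ⊆ X) (hf : f ∈ D.inside H Q) :
    D.IsBase m E V (insert e (H.erase f)) where
  subset := insert_subset he ((erase_subset _ _).trans hH.subset)
  sparse := hH.sparse.exchange hmin hf
  card_add := by
    rw [card_insert_of_notMem fun h => heH (mem_of_mem_erase h),
      card_erase_add_one (inside_subset hf), hH.card_add]

lemma Sparse.exists_incident_mem_inside_of_tight (hm : 1 ≤ m) (hH : D.Sparse m H)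
    (hQ : D.Tight m H Q) (hu : u ∈ Q) (hx : x ∈ Q) (hxu : x ≠ u) :
    ∃ f ∈ D.inside H Q, D.src f = u ∨ D.tgt f = u := by
  by_contra! hnone
  have hsub : D.inside H Q ⊆ D.inside H (Q.erase u) := fun f hf => by
    have := hnone f hf
    rw [mem_inside] at hf ⊢
    simp [hf, this]
  have hcard := card_le_card hsub
  have hsparse := hH (Q.erase u) ⟨x, mem_erase.2 ⟨hxu, hx⟩⟩
  have hQeq := hQ.2
  rw [← card_erase_add_one hu, mul_add, mul_one] at hQeq
  omega

end Exchange

section Obstruction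

variable {α β : Type*} {D : EdgeEnds α β} {m η n : ℕ} {E H K L : Finset β}
  {V U X Y Z Q : Finset α} {u v : α} {e f : β}

/-- Inside the tight set `X`, which avoids `U` and contains `v`, the base `H` can be changed into
the base `K`, in which the degrees in `X` are at most `η` and that of `v` is even smaller. -/
structure IsReduction (D : EdgeEnds α β) (m η : ℕ) (E : Finset β) (V : Finset α) (H : Finset β)
    (U : Finset α) (v : α) (K : Finset β) (X : Finset α) : Prop where
  isBase : D.IsBase m E V K
  tight : D.Tight m H X
  subset : X ⊆ V
  disjoint : Disjoint X U
  mem : v ∈ X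
  agreeOff : D.AgreeOff X K H
  deg_le : ∀ w ∈ X, D.deg K w ≤ η
  deg_lt : D.deg K v < η

/-- The vertices of degree more than `η`, and then repeatedly the vertices for which there is no
reduction avoiding the previous set. -/
noncomputable def obstruction (D : EdgeEnds α β) (m η : ℕ) (E : Finset β) (V : Finset α)
    (H : Finset β) : ℕ → Finset α
  | 0 => {v ∈ V | η < D.deg H v}
  | n + 1 => {v ∈ V | ¬ ∃ K X, D.IsReduction m η E V H (obstruction D m η E V H n) v K X}

lemma mem_obstruction_zero : v ∈ D.obstruction m η E V H 0 ↔ v ∈ V ∧ η < D.deg H v := mem_filter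

lemma mem_obstruction_succ : v ∈ D.obstruction m η E V H (n + 1) ↔
    v ∈ V ∧ ¬ ∃ K X, D.IsReduction m η E V H (D.obstruction m η E V H n) v K X := mem_filter

lemma obstruction_subset : D.obstruction m η E V H n ⊆ V := by
  cases n <;> exact filter_subset _ _

lemma monotone_obstruction : Monotone (D.obstruction m η E V H) := by
  refine monotone_nat_of_le_succ fun n v hv => mem_obstruction_succ.2 ⟨obstruction_subset hv, ?_⟩
  rintro ⟨K, X, h⟩
  exact disjoint_left.1 h.disjoint h.mem hv

lemma exists_obstruction_succ_eq :
    ∃ n, D.obstruction m η E V H (n + 1) = D.obstruction m η E V H n := by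
  obtain ⟨i, j, hij, heq⟩ := Finite.exists_ne_map_eq_of_infinite fun n =>
    (⟨D.obstruction m η E V H n, mem_powerset.2 obstruction_subset⟩ : V.powerset)
  wlog hlt : i < j generalizing i j
  · exact this j i hij.symm heq.symm (by omega)
  refine ⟨i, (?_ : _ ≤ _).antisymm (monotone_obstruction i.le_succ)⟩
  exact (monotone_obstruction hlt).trans_eq (Subtype.ext_iff.1 heq).symm

lemma IsBase.le_deg_of_mem_obstruction (hH : D.IsBase m E V H)
    (hv : v ∈ D.obstruction m η E V H n) : η ≤ D.deg H v := by
  induction n with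
  | zero => exact (mem_obstruction_zero.1 hv).2.le
  | succ n ih =>
    by_cases hvn : v ∈ D.obstruction m η E V H n
    · exact ih hvn
    · by_contra! hlt
      exact (mem_obstruction_succ.1 hv).2 ⟨H, {v}, hH, hH.sparse.tight_singleton v,
        singleton_subset_iff.2 (obstruction_subset hv), disjoint_singleton_left.2 hvn,
        mem_singleton_self v, fun _ _ => Iff.rfl, by simpa using hlt.le, hlt⟩

lemma IsBase.exists_isReduction_of_obstruction_succ_eq
    (hn : D.obstruction m η E V H (n + 1) = D.obstruction m η E V H n) (hv : v ∈ V)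
    (hvn : v ∉ D.obstruction m η E V H n) :
    ∃ K X, D.IsReduction m η E V H (D.obstruction m η E V H n) v K X := by
  by_contra hr
  exact hvn (hn ▸ mem_obstruction_succ.2 ⟨hv, hr⟩)

/-- A vertex whose degree drops when the base is changed inside a tight set cannot be in the first
obstruction set that meets this tight set. -/
lemma notMem_obstruction_of_deg_lt
    (hmin : ∀ K, D.IsBase m E V K → D.excess η V H ≤ D.excess η V K) (hK : D.IsBase m E V K)
    (hZ : D.Tight m H Z) (hZV : Z ⊆ V) (hagree : D.AgreeOff Z K H)
    (hdeg : ∀ w, D.deg K w ≤ max η (D.deg H w)) (hu : u ∈ Z) (hlt : D.deg K u < D.deg H u)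
    (hdisj : ∀ i < n, Disjoint Z (D.obstruction m η E V H i)) :
    u ∉ D.obstruction m η E V H n := by
  intro hun
  cases n with
  | zero =>
    exact (excess_lt_excess hdeg (hZV hu) (mem_obstruction_zero.1 hun).2 hlt).not_ge (hmin K hK)
  | succ k =>
    have hHη {w : α} (hw : w ∈ Z) : D.deg H w ≤ η := by
      by_contra! hlt
      exact disjoint_left.1 (hdisj 0 k.succ_pos) hw (mem_obstruction_zero.2 ⟨hZV hw, hlt⟩)
    exact (mem_obstruction_succ.1 hun).2 ⟨K, Z, hK, hZ, hZV, hdisj k k.lt_succ_self, hu, hagree,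
      fun w hw => (hdeg w).trans (max_le le_rfl (hHη hw)), hlt.trans_le (hHη hu)⟩

/-- The base `L` results from `H` by reductions for both ends of `e` in the disjoint tight sets `X`
and `Y`. -/
structure IsDoubleReduction (D : EdgeEnds α β) (m η : ℕ) (E : Finset β) (V : Finset α)
    (H : Finset β) (e : β) (L : Finset β) (X Y : Finset α) : Prop where
  isBase : D.IsBase m E V L
  tight_left : D.Tight m L X
  tight_right : D.Tight m L Y
  src_mem : D.src e ∈ X
  tgt_mem : D.tgt e ∈ Y
  mem_iff : ∀ g, ¬ (D.src g ∈ X ∧ D.tgt g ∈ X) → ¬ (D.src g ∈ Y ∧ D.tgt g ∈ Y) →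
    (g ∈ L ↔ g ∈ H)
  deg_le : ∀ w ∈ X ∪ Y, D.deg L w ≤ η
  src_deg_lt : D.deg L (D.src e) < η
  tgt_deg_lt : D.deg L (D.tgt e) < η

lemma IsReduction.isDoubleReduction_swap {K₁ K₂ : Finset β} (hH : D.IsBase m E V H)
    (h₁ : D.IsReduction m η E V H U (D.src e) K₁ X)
    (h₂ : D.IsReduction m η E V H U (D.tgt e) K₂ Y) (hXY : Disjoint X Y) :
    D.IsDoubleReduction m η E V H e (D.swap K₁ K₂ Y) X Y := by
  have hcard₁ := h₁.isBase.card_eq hH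
  have hcard₂ := h₂.isBase.card_eq hH
  have hX₁ : D.Tight m K₁ X := (h₁.agreeOff.tight_iff hcard₁ subset_rfl).2 h₁.tight
  have hY₁ : D.Tight m K₁ Y := by
    rw [Tight, h₁.agreeOff.inside_eq_of_disjoint hXY]
    exact h₂.tight
  have hY₂ : D.Tight m K₂ Y := (h₂.agreeOff.tight_iff hcard₂ subset_rfl).2 h₂.tight
  have hdegX {w : α} (hw : w ∈ X) : D.deg (D.swap K₁ K₂ Y) w = D.deg K₁ w :=
    agreeOff_swap.deg_eq (disjoint_left.1 hXY hw)
  have hdegY {w : α} (hw : w ∈ Y) : D.deg (D.swap K₁ K₂ Y) w = D.deg K₂ w := by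
    refine deg_congr fun g hg => ?_
    have hg₁ := h₁.agreeOff.mem_iff_of_incident (disjoint_right.1 hXY hw) hg
    have hg₂ := h₂.agreeOff g
    simp only [swap, mem_union, mem_filter, mem_inside]
    tauto
  exact
    { isBase := h₁.isBase.swap h₂.isBase hY₁ hY₂
      tight_left := by rwa [Tight, agreeOff_swap.inside_eq_of_disjoint hXY.symm]
      tight_right := by rwa [Tight, inside_swap]
      src_mem := h₁.mem
      tgt_mem := h₂.mem
      mem_iff := fun g hX hY => (agreeOff_swap g hY).trans (h₁.agreeOff g hX)
      deg_le := fun w hw => (mem_union.1 hw).elim (fun hw => hdegX hw ▸ h₁.deg_le w hw)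
        fun hw => hdegY hw ▸ h₂.deg_le w hw
      src_deg_lt := hdegX h₁.mem ▸ h₁.deg_lt
      tgt_deg_lt := hdegY h₂.mem ▸ h₂.deg_lt }

namespace IsDoubleReduction

variable (h : D.IsDoubleReduction m η E V H e L X Y)
include h

lemma agreeOff : D.AgreeOff (X ∪ Y) L H := fun g hg => h.mem_iff g
  (fun hX => hg ⟨mem_union_left _ hX.1, mem_union_left _ hX.2⟩)
  fun hY => hg ⟨mem_union_right _ hY.1, mem_union_right _ hY.2⟩

lemma notMem (hXY : Disjoint X Y) (heH : e ∉ H) : e ∉ L := by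
  rwa [h.mem_iff e (fun hX => disjoint_left.1 hXY hX.2 h.tgt_mem)
    fun hY => disjoint_left.1 hXY h.src_mem hY.1]

lemma tight_union (hH : D.IsBase m E V H) (hQ : D.Tight m L Q) (hsrc : D.src e ∈ Q)
    (htgt : D.tgt e ∈ Q) : D.Tight m H (Q ∪ (X ∪ Y)) := by
  rw [← h.agreeOff.tight_iff (h.isBase.card_eq hH) subset_union_right, ← union_assoc]
  exact h.isBase.sparse.tight_union (h.isBase.sparse.tight_union hQ h.tight_left
    ⟨_, mem_inter.2 ⟨hsrc, h.src_mem⟩⟩) h.tight_right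
    ⟨_, mem_inter.2 ⟨mem_union_left _ htgt, h.tgt_mem⟩⟩

lemma notIncident (hu : u ∉ X ∪ Y) : ¬ (D.src e = u ∨ D.tgt e = u) := by
  rintro (rfl | rfl)
  exacts [hu (mem_union_left _ h.src_mem), hu (mem_union_right _ h.tgt_mem)]

lemma deg_exchange_le_max (w : α) :
    D.deg (insert e (L.erase f)) w ≤ max η (D.deg H w) := by
  by_cases he : D.src e = w ∨ D.tgt e = w
  · have hlt : D.deg L w < η := by
      rcases he with rfl | rfl
      exacts [h.src_deg_lt, h.tgt_deg_lt]
    exact le_max_of_le_left (deg_exchange_le_add_one.trans hlt)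
  · refine (deg_exchange_le he).trans ?_
    by_cases hw : w ∈ X ∪ Y
    · exact le_max_of_le_left (h.deg_le w hw)
    · exact le_max_of_le_right (h.agreeOff.deg_eq hw).le

lemma deg_exchange_lt (hu : u ∉ X ∪ Y) (hf : f ∈ L) (hfu : D.src f = u ∨ D.tgt f = u) :
    D.deg (insert e (L.erase f)) u < D.deg H u := by
  rw [← h.agreeOff.deg_eq hu]
  exact EdgeEnds.deg_exchange_lt (h.notIncident hu) hf hfu

end IsDoubleReduction

/-- If the smallest tight set `Q` of `L` that contains the ends of `e` met the obstruction in a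
vertex `u`, inserting `e` in exchange for an edge at `u` would decrease the degree of `u`. -/
lemma IsDoubleReduction.notMem_obstruction (h : D.IsDoubleReduction m η E V H e L X Y)
    (hm : 1 ≤ m) (hH : D.IsBase m E V H)
    (hmin : ∀ K, D.IsBase m E V K → D.excess η V H ≤ D.excess η V K) (he : e ∈ E) (heL : e ∉ L)
    (hQ : D.Tight m L Q) (hsrc : D.src e ∈ Q) (htgt : D.tgt e ∈ Q)
    (hQmin : ∀ Z, D.Tight m L Z → D.src e ∈ Z → D.tgt e ∈ Z → Q ⊆ Z)
    (hZV : Q ∪ (X ∪ Y) ⊆ V) (hu : u ∈ Q) (huXY : u ∉ X ∪ Y)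
    (hdisj : ∀ i < n, Disjoint (Q ∪ (X ∪ Y)) (D.obstruction m η E V H i)) :
    u ∉ D.obstruction m η E V H n := by
  obtain ⟨f, hf, hfu⟩ := h.isBase.sparse.exists_incident_mem_inside_of_tight hm hQ hu hsrc
    fun hsrc_eq => h.notIncident huXY (.inl hsrc_eq)
  exact notMem_obstruction_of_deg_lt hmin (h.isBase.exchange he heL hQmin hf)
    (h.tight_union hH hQ hsrc htgt) hZV
    ((h.agreeOff.mono subset_union_right).exchange subset_union_left (mem_union_left _ hsrc)
      (mem_union_left _ htgt) hf)
    h.deg_exchange_le_max (mem_union_left _ hu)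
    (h.deg_exchange_lt huXY (inside_subset hf) hfu) hdisj

lemma IsBase.exists_tight_of_isReduction (hm : 1 ≤ m) (hE : D.EndsIn E V)
    (hH : D.IsBase m E V H)
    (hmin : ∀ K, D.IsBase m E V K → D.excess η V H ≤ D.excess η V K) (he : e ∈ E) (heH : e ∉ H)
    {K₁ K₂ : Finset β}
    (h₁ : D.IsReduction m η E V H (D.obstruction m η E V H n) (D.src e) K₁ X)
    (h₂ : D.IsReduction m η E V H (D.obstruction m η E V H n) (D.tgt e) K₂ Y) :
    ∃ Z ⊆ V, Disjoint Z (D.obstruction m η E V H n) ∧ D.Tight m H Z ∧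
      D.src e ∈ Z ∧ D.tgt e ∈ Z := by
  have hXYV : X ∪ Y ⊆ V := union_subset h₁.subset h₂.subset
  have hXYU : Disjoint (X ∪ Y) (D.obstruction m η E V H n) :=
    disjoint_union_left.2 ⟨h₁.disjoint, h₂.disjoint⟩
  by_cases hXY : (X ∩ Y).Nonempty
  · exact ⟨X ∪ Y, hXYV, hXYU, hH.sparse.tight_union h₁.tight h₂.tight hXY,
      mem_union_left _ h₁.mem, mem_union_right _ h₂.mem⟩
  rw [not_nonempty_iff_eq_empty, ← disjoint_iff_inter_eq_empty] at hXY
  have hL := h₁.isDoubleReduction_swap hH h₂ hXY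
  obtain ⟨hsrcV, htgtV⟩ := hE e he
  have hV := hL.isBase.tight hE ⟨_, hsrcV⟩
  obtain ⟨Q, hQ, hsrc, htgt, hQmin⟩ := hL.isBase.sparse.exists_minimal_tight hV hsrcV htgtV
  have hZV : Q ∪ (X ∪ Y) ⊆ V := union_subset (hQmin V hV hsrcV htgtV) hXYV
  have hZ := hL.tight_union hH hQ hsrc htgt
  refine ⟨_, hZV, ?_, hZ, mem_union_left _ hsrc, mem_union_left _ htgt⟩
  have hdisj : ∀ j ≤ n, Disjoint (Q ∪ (X ∪ Y)) (D.obstruction m η E V H j) := by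
    intro j
    induction j using Nat.strong_induction_on with
    | _ j ih =>
      intro hj
      have hXYj := hXYU.mono_right (monotone_obstruction (η := η) hj)
      refine disjoint_union_left.2 ⟨disjoint_left.2 fun u hu => ?_, hXYj⟩
      by_cases huXY : u ∈ X ∪ Y
      · exact disjoint_left.1 hXYj huXY
      · exact hL.notMem_obstruction hm hH hmin he (hL.notMem hXY heH) hQ hsrc htgt hQmin hZV hu
          huXY fun i hi => ih i hi (hi.le.trans hj)
  exact hdisj n le_rfl

end Obstruction

section BoundedDegree

variable {α β : Type*} {D : EdgeEnds α β} {G : Graph α β} {m η : ℕ} {E I K : Finset β}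
  {V S : Finset α} {v : α}

/-- A failure certificate `S` for the degree bound `η`: in the base `K` the vertices of `S` have
degree at least `η`, not all of them equal to `η`, and all edges outside `K` that avoid `S` have
their ends in a common tight set that avoids `S`. -/
structure IsDegreeObstruction (D : EdgeEnds α β) (m η : ℕ) (E : Finset β) (V : Finset α)
    (K : Finset β) (S : Finset α) : Prop where
  isBase : D.IsBase m E V K
  subset : S ⊆ V
  le_deg : ∀ v ∈ S, η ≤ D.deg K v
  exists_lt_deg : ∃ v ∈ S, η < D.deg K v
  exists_tight : ∀ e ∈ E, e ∉ K → D.src e ∉ S → D.tgt e ∉ S →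
    ∃ Z ⊆ V, Disjoint Z S ∧ D.Tight m K Z ∧ D.src e ∈ Z ∧ D.tgt e ∈ Z

lemma IsBase.exists_isDegreeObstruction (hm : 1 ≤ m) (hE : D.EndsIn E V)
    (hK : D.IsBase m E V K)
    (hmin : ∀ L, D.IsBase m E V L → D.excess η V K ≤ D.excess η V L) (hv : v ∈ V)
    (hlt : η < D.deg K v) : ∃ S, D.IsDegreeObstruction m η E V K S := by
  obtain ⟨n, hn⟩ := exists_obstruction_succ_eq (D := D) (m := m) (η := η) (E := E) (V := V)
    (H := K)
  refine ⟨_, hK, obstruction_subset, fun w hw => hK.le_deg_of_mem_obstruction hw,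
    ⟨v, monotone_obstruction n.zero_le (mem_obstruction_zero.2 ⟨hv, hlt⟩), hlt⟩, ?_⟩
  intro e he heK hsrc htgt
  obtain ⟨K₁, X, h₁⟩ := exists_isReduction_of_obstruction_succ_eq hn (hE e he).1 hsrc
  obtain ⟨K₂, Y, h₂⟩ := exists_isReduction_of_obstruction_succ_eq hn (hE e he).2 htgt
  exact hK.exists_tight_of_isReduction hm hE hmin he heK h₁ h₂

lemma IsBase.exists_deg_le_or_isDegreeObstruction (hm : 1 ≤ m) (hE : D.EndsIn E V)
    (hI : D.IsBase m E V I) (η : ℕ) :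
    ∃ K, D.IsBase m E V K ∧
      ((∀ v ∈ V, D.deg K v ≤ η) ∨ ∃ S, D.IsDegreeObstruction m η E V K S) := by
  have hmem {K : Finset β} : K ∈ E.powerset.filter (D.IsBase m E V) ↔ D.IsBase m E V K :=
    mem_filter.trans (and_iff_right_of_imp fun hK => mem_powerset.2 hK.subset)
  obtain ⟨K, hK, hmin⟩ := exists_min_image _ (D.excess η V) ⟨I, hmem.2 hI⟩
  refine ⟨K, hmem.1 hK, or_iff_not_imp_left.2 fun hdeg => ?_⟩
  push Not at hdeg
  obtain ⟨v, hv, hlt⟩ := hdeg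
  exact (hmem.1 hK).exists_isDegreeObstruction hm hE (fun L hL => hmin L (hmem.2 hL)) hv hlt

namespace IsDegreeObstruction

lemma card_inside_sdiff_lt (h : D.IsDegreeObstruction m η E V K S) (hE : D.EndsIn E V) :
    η * #S + #(D.inside K (V \ S)) + 2 * m < m * #S + m * #V := by
  have hsum := sum_deg_add_card_inside_sdiff
    (fun _ => h.isBase.sparse.src_ne_tgt) (hE.mono h.isBase.subset) S
  have hlt : η * #S < ∑ v ∈ S, D.deg K v := by
    rw [mul_comm, ← smul_eq_mul, ← sum_const]
    exact sum_lt_sum h.le_deg h.exists_lt_deg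
  obtain ⟨v, hv, -⟩ := h.exists_lt_deg
  have hsparse := h.isBase.sparse S ⟨v, hv⟩
  have hcard := h.isBase.card_add
  omega

lemma isSparseBasis (h : D.IsDegreeObstruction m η E V K S) :
    D.IsSparseBasis m (V \ S) (D.inside E (V \ S)) (D.inside K (V \ S)) where
  subset := inside_subset_inside h.isBase.subset
  sparse := h.isBase.sparse.mono inside_subset
  exists_tight e he heK := by
    rw [mem_inside] at he heK
    obtain ⟨heE, hsrc, htgt⟩ := he
    obtain ⟨Z, hZV, hZS, hZ, hends⟩ := h.exists_tight e heE (fun heK' => heK ⟨heK', hsrc, htgt⟩)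
      (mem_sdiff.1 hsrc).2 (mem_sdiff.1 htgt).2
    have hZVS : Z ⊆ V \ S := subset_sdiff.2 ⟨hZV, hZS⟩
    exact ⟨Z, hZVS, by rwa [Tight, inside_inside_of_subset hZVS], hends⟩

end IsDegreeObstruction

lemma Represents.deleteVerts (h : D.Represents G V E) (S : Finset α) :
    D.Represents (G.deleteVerts (S : Set α)) (V \ S) (D.inside E (V \ S)) where
  isEndsOf := h.isEndsOf.of_le deleteVerts_le
  vertexSet_eq := by rw [vertexSet_deleteVerts, h.vertexSet_eq, coe_sdiff]
  edgeSet_eq := by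
    rw [← h.isEndsOf.edgeSet_induce h.edgeSet_eq, Graph.deleteVerts, h.vertexSet_eq, coe_sdiff]

lemma IsDegreeObstruction.lt_mul_Omega (hS : D.IsDegreeObstruction m η E V K S)
    (h : D.Represents G V E) (hm : 1 ≤ m) :
    ((η : ℝ) - 2 * m) * #S + 2 * m < m * Omega m (G.deleteVerts (S : Set α)) := by
  have hlt : (η * #S + #(D.inside K (V \ S)) + 2 * m : ℝ) < m * #S + m * #V :=
    mod_cast hS.card_inside_sdiff_lt h.endsIn
  have hcard : (#(V \ S) + #S : ℝ) = #V := mod_cast card_sdiff_add_card_eq_card hS.subset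
  rw [(h.deleteVerts S).mul_Omega hS.isSparseBasis hm]
  rw [← hcard] at hlt
  linarith

lemma IsSparseBasis.isBase (hI : D.IsSparseBasis m V E I) (h : D.Represents G V E) (hm : 1 ≤ m)
    (hV : V.Nonempty) (hΩ : Omega m G ≤ 1) : D.IsBase m E V I := by
  refine ⟨hI.subset, hI.sparse, ?_⟩
  have hmΩ : (m : ℝ) * Omega m G ≤ m := mul_le_of_le_one_right m.cast_nonneg hΩ
  rw [h.mul_Omega hI hm, sub_le_iff_le_add] at hmΩ
  have hge : m * #V ≤ m + #I := mod_cast hmΩ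
  have hle := hI.sparse V hV
  rw [(h.endsIn.mono hI.subset).inside_eq] at hle
  omega

lemma IsEndsOf.edgeDegree_restrict_le (h : D.IsEndsOf G) (F : Finset β) (v : α) :
    (G.restrict (F : Set β)).edgeDegree v ≤ D.deg F v := by
  rw [edgeDegree, deg, ← Set.ncard_coe_finset]
  refine Set.ncard_le_ncard (fun e he => ?_) (finite_toSet _)
  rw [mem_incidenceSet, restrict_inc] at he
  have hends := he.1.eq_or_eq_of_isLink (h he.1.edge_mem)
  rw [mem_coe, mem_filter]
  exact ⟨he.2, hends.imp Eq.symm Eq.symm⟩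

lemma IsBase.isTreeConnected_restrict (hK : D.IsBase m E V K) (h : D.Represents G V E)
    (hV : V.Nonempty) : IsTreeConnected m (G.restrict (K : Set β)) := by
  obtain ⟨F, hF⟩ := hK.sparse.exists_isConnectingPacking (h.endsIn.mono hK.subset) hK.card_add.ge
  refine (h.isEndsOf.of_le restrict_le).isTreeConnected h.vertexSet_eq hV ?_ hF
  rw [edgeSet_restrict, h.edgeSet_eq]
  exact Set.subset_inter (coe_subset.2 hK.subset) subset_rfl

end BoundedDegree

end EdgeEnds

section BoundedDegree

variable {α β : Type*} {G : Graph α β} {m η : ℕ}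

lemma exists_represents (hV : V(G).Finite) (hE : E(G).Finite) (hne : V(G).Nonempty) :
    ∃ (D : EdgeEnds α β) (V : Finset α) (E : Finset β), D.Represents G V E := by
  obtain ⟨D, hD⟩ := EdgeEnds.exists_isEndsOf hne
  exact ⟨D, hV.toFinset, hE.toFinset, hD, hV.coe_toFinset.symm, hE.coe_toFinset.symm⟩

/-- A base of minimum excess either satisfies the degree bound or has an obstruction `S`. In the
latter case the base restricted to the complement of `S` is a sparse basis there, and counting its
edges contradicts the bound on `Omega m (G.deleteVerts S)`. -/
theorem exists_isTreeConnected_edgeDegree_le (hm : 1 ≤ m) (hV : V(G).Finite) (hE : E(G).Finite)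
    (hne : V(G).Nonempty) (hΩ : Omega m G ≤ 1)
    (hdel : ∀ S ⊆ V(G), m * Omega m (G.deleteVerts S) ≤ (η - 2 * m) * S.ncard + 2 * m) :
    ∃ H : Graph α β, H ≤s G ∧ IsTreeConnected m H ∧ ∀ v ∈ V(H), H.edgeDegree v ≤ η := by
  obtain ⟨D, V, E, h⟩ := exists_represents hV hE hne
  have hVne : V.Nonempty := by rwa [← coe_nonempty, ← h.vertexSet_eq]
  obtain ⟨I, hI⟩ := EdgeEnds.exists_isSparseBasis m h.endsIn
  obtain ⟨K, hK, hdeg | ⟨S, hS⟩⟩ :=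
    (hI.isBase h hm hVne hΩ).exists_deg_le_or_isDegreeObstruction hm h.endsIn η
  · refine ⟨G.restrict (K : Set β), ⟨restrict_le, rfl⟩, hK.isTreeConnected_restrict h hVne,
      fun v hv => (h.isEndsOf.edgeDegree_restrict_le K v).trans (hdeg v ?_)⟩
    rwa [vertexSet_restrict, h.vertexSet_eq, mem_coe] at hv
  · have hle := hdel S (h.vertexSet_eq ▸ coe_subset.2 hS.subset)
    rw [Set.ncard_coe_finset] at hle
    exact absurd hle (hS.lt_mul_Omega h hm).not_ge

theorem exists_isTreeConnected_of_isStronglyTough (hm : 1 ≤ m) (hV : V(G).Finite)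
    (hE : E(G).Finite) (hne : V(G).Nonempty) (hG : IsStronglyTough m m G) :
    ∃ H : Graph α β, H ≤s G ∧ IsTreeConnected m H ∧
      ∀ v ∈ V(H), H.edgeDegree v ≤ 2 * m + 1 := by
  have hm' : (m : ℝ) ≠ 0 := by positivity
  refine exists_isTreeConnected_edgeDegree_le hm hV hE hne
    (by simpa using hG ∅ (Set.empty_subset _)) fun S hS => ?_
  calc m * Omega m (G.deleteVerts S)
    _ ≤ m * max 1 (1 / m * (S.ncard : ℝ)) := mul_le_mul_of_nonneg_left (hG S hS) m.cast_nonneg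
    _ = max (m : ℝ) S.ncard := by
      rw [mul_max_of_nonneg _ _ m.cast_nonneg, mul_one, ← mul_assoc, mul_one_div_cancel hm',
        one_mul]
    _ ≤ S.ncard + m := max_le (by simp) (by simp)
    _ ≤ ((2 * m + 1 : ℕ) - 2 * m) * S.ncard + 2 * m := by
      push_cast
      linarith [m.cast_nonneg (α := ℝ)]

end BoundedDegree

section Complete

variable {α β : Type*} {D : EdgeEnds α β} {G : Graph α β} {n m : ℕ} {g : ZMod n → α}
  {c : Sym2 (ZMod n) → β} {k l : ZMod n} {v : α}

/-- The vertices of the complete graph `G` are labelled by the integers modulo `n`, and `c` chooses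
an edge for any two distinct labels; its values on the diagonal are irrelevant. -/
structure IsCompleteLabelling (G : Graph α β) (g : ZMod n → α) (c : Sym2 (ZMod n) → β) :
    Prop where
  injective : Function.Injective g
  range_eq : Set.range g = V(G)
  isLink : ∀ r s, r ≠ s → G.IsLink (c s(r, s)) (g r) (g s)

lemma exists_isCompleteLabelling (hV : V(G).Finite) (hn : 2 ≤ V(G).ncard)
    (hG : ∀ x ∈ V(G), ∀ y ∈ V(G), x ≠ y → G.Adj x y) :
    ∃ (g : ZMod V(G).ncard → α) (c : Sym2 (ZMod V(G).ncard) → β), IsCompleteLabelling G g c := by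
  have : NeZero V(G).ncard := ⟨by omega⟩
  have := hV.fintype
  let φ : ZMod V(G).ncard ≃ V(G) := Fintype.equivOfCardEq (by
    rw [ZMod.card, ← Nat.card_coe_set_eq, Nat.card_eq_fintype_card])
  obtain ⟨x, hx, y, hy, hxy⟩ := (Set.one_lt_ncard hV).1 hn
  obtain ⟨e₀, -⟩ := hG x hx y hy hxy
  have hedge (p : Sym2 (ZMod V(G).ncard)) :
      ∃ e, ∀ r s, r ≠ s → p = s(r, s) → G.IsLink e (φ r) (φ s) := by
    induction p with
    | _ r s =>
      rcases eq_or_ne r s with rfl | hrs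
      · refine ⟨e₀, fun t u htu hp => absurd ?_ htu⟩
        rcases Sym2.eq_iff.1 hp with ⟨rfl, rfl⟩ | ⟨rfl, rfl⟩ <;> rfl
      · obtain ⟨e, he⟩ := hG (φ r) (φ r).2 (φ s) (φ s).2
          fun h => hrs (φ.injective (Subtype.ext h))
        refine ⟨e, fun t u _ hp => ?_⟩
        rcases Sym2.eq_iff.1 hp with ⟨rfl, rfl⟩ | ⟨rfl, rfl⟩
        exacts [he, he.symm]
  choose c hc using hedge
  refine ⟨fun r => φ r, c, Subtype.val_injective.comp φ.injective, ?_,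
    fun r s hrs => hc _ r s hrs rfl⟩
  rw [Set.range_comp' Subtype.val φ, φ.range_eq_univ, Set.image_univ, Subtype.range_coe]

variable [NeZero n]

/-- The matching that consists of the chosen edges between labels with sum `k`. -/
noncomputable def sumClass (c : Sym2 (ZMod n) → β) (k : ZMod n) : Finset β :=
  ({r | r ≠ k - r} : Finset (ZMod n)).image fun r => c s(r, k - r)

lemma mem_sumClass {e : β} : e ∈ sumClass c k ↔ ∃ r, r ≠ k - r ∧ c s(r, k - r) = e := by
  simp [sumClass]

namespace IsCompleteLabelling

variable (h : IsCompleteLabelling G g c)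
include h

lemma eq_of_mem_sumClass_of_inc {e : β} (he : e ∈ sumClass c k) (hinc : G.Inc e (g l)) :
    e = c s(l, k - l) := by
  obtain ⟨r, hr, rfl⟩ := mem_sumClass.1 he
  rcases hinc.eq_or_eq_of_isLink (h.isLink _ _ hr) with heq | heq <;> obtain rfl := h.injective heq
  · rfl
  · rw [sub_sub_cancel, Sym2.eq_swap]

lemma sumClass_subset : (sumClass c k : Set β) ⊆ E(G) := fun e he => by
  obtain ⟨r, hr, rfl⟩ := mem_sumClass.1 (mem_coe.1 he)
  exact (h.isLink _ _ hr).edge_mem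

lemma disjoint_sumClass (hkl : k ≠ l) : Disjoint (sumClass c k) (sumClass c l) := by
  refine Finset.disjoint_left.2 fun e hk hl => hkl ?_
  obtain ⟨r, hr, rfl⟩ := mem_sumClass.1 hk
  obtain ⟨s, hs, heq⟩ := mem_sumClass.1 hl
  have hlink := h.isLink r _ hr
  rw [← heq] at hlink
  suffices r + (k - r) = s + (l - s) by simpa using this
  rcases hlink.eq_and_eq_or_eq_and_eq (h.isLink s _ hs) with ⟨hr_eq, hs_eq⟩ | ⟨hr_eq, hs_eq⟩
  · exact congrArg₂ (· + ·) (h.injective hr_eq) (h.injective hs_eq)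
  · exact (congrArg₂ (· + ·) (h.injective hr_eq) (h.injective hs_eq)).trans (add_comm _ _)

lemma deg_sumClass_le_one (hD : D.IsEndsOf G) (hv : v ∈ V(G)) : D.deg (sumClass c k) v ≤ 1 := by
  obtain ⟨l, rfl⟩ : v ∈ Set.range g := h.range_eq ▸ hv
  have heq {e : β} (he : e ∈ sumClass c k) (hel : D.src e = g l ∨ D.tgt e = g l) :
      e = c s(l, k - l) := by
    refine h.eq_of_mem_sumClass_of_inc he ?_
    have hlink := hD (h.sumClass_subset (mem_coe.2 he))
    rcases hel with hl | hl
    exacts [hl ▸ hlink.inc_left, hl ▸ hlink.inc_right]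
  refine card_le_one.2 fun e he f hf => ?_
  rw [mem_filter] at he hf
  exact (heq he.1 he.2).trans (heq hf.1 hf.2).symm

lemma conn_sumClass (hD : D.IsEndsOf G) (k r : ZMod n) :
    D.Conn (sumClass c k) (g r) (g (k - r)) := by
  by_cases hr : r = k - r
  · rw [← hr]
    exact .refl _ _
  · exact hD.conn_of_isLink (h.isLink _ _ hr) (mem_coe.2 (mem_sumClass.2 ⟨r, hr, rfl⟩))

/-- The reflections `r ↦ k - r` and `r ↦ k + 1 - r` compose to `r ↦ r + 1`: the two matchings form
a Hamiltonian path. -/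
lemma connects_sumClass_union (hD : D.IsEndsOf G) {V : Finset α} (hV : V(G) = V) (k : ZMod n) :
    D.Connects (sumClass c k ∪ sumClass c (k + 1) : Finset β) V := by
  have hstep (r : ZMod n) :
      D.Conn (sumClass c k ∪ sumClass c (k + 1) : Finset β) (g r) (g (r + 1)) := by
    have hreflect := h.conn_sumClass hD (k + 1) (k - r)
    rw [show k + 1 - (k - r) = r + 1 by ring] at hreflect
    exact ((h.conn_sumClass hD k r).mono (coe_subset.2 subset_union_left)).trans
      (hreflect.mono (coe_subset.2 subset_union_right))
  have hzero (r : ℕ) :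
      D.Conn (sumClass c k ∪ sumClass c (k + 1) : Finset β) (g 0) (g r) := by
    induction r with
    | zero => simpa using EdgeEnds.Conn.refl _ _
    | succ r ih => simpa using ih.trans (hstep r)
  intro x hx y hy
  rw [← mem_coe, ← hV, ← h.range_eq] at hx hy
  obtain ⟨⟨r, rfl⟩, s, rfl⟩ := And.intro hx hy
  simpa using (hzero r.val).symm.trans (hzero s.val)

lemma isConnectingPacking (hD : D.IsEndsOf G) {V : Finset α} (hV : V(G) = V) (hn : 2 * m ≤ n) :
    D.IsConnectingPacking ((range (2 * m)).biUnion fun k => sumClass c k) V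
      fun i : Fin m => sumClass c (2 * i : ℕ) ∪ sumClass c (2 * i + 1 : ℕ) where
  subset i := union_subset
    (subset_biUnion_of_mem (fun k : ℕ => sumClass c k) (mem_range.2 (by omega)))
    (subset_biUnion_of_mem (fun k : ℕ => sumClass c k) (mem_range.2 (by omega)))
  disjoint i j hij := by
    have hij' : (i : ℕ) ≠ j := Fin.val_ne_of_ne hij
    have hdisj {k l : ℕ} (hk : k < n) (hl : l < n) (hkl : k ≠ l) :
        Disjoint (sumClass c k) (sumClass c l) := by
      refine h.disjoint_sumClass fun heq => hkl ?_
      rwa [ZMod.natCast_eq_natCast_iff, Nat.ModEq, Nat.mod_eq_of_lt hk, Nat.mod_eq_of_lt hl] at heq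
    simp only [disjoint_union_left, disjoint_union_right]
    refine ⟨⟨?_, ?_⟩, ?_, ?_⟩ <;> exact hdisj (by omega) (by omega) (by omega)
  connects i := by
    simpa only [Nat.cast_add_one] using h.connects_sumClass_union hD hV (2 * i : ℕ)

end IsCompleteLabelling

theorem exists_isTreeConnected_of_complete (hm : 1 ≤ m) (hV : V(G).Finite)
    (hG : ∀ x ∈ V(G), ∀ y ∈ V(G), x ≠ y → G.Adj x y) (hn : 2 * m ≤ V(G).ncard) :
    ∃ H : Graph α β, H ≤s G ∧ IsTreeConnected m H ∧ ∀ v ∈ V(H), H.edgeDegree v ≤ 2 * m := by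
  obtain ⟨g, c, h⟩ := exists_isCompleteLabelling hV (by omega) hG
  have : NeZero V(G).ncard := ⟨by omega⟩
  have hne : V(G).Nonempty := Set.nonempty_of_ncard_ne_zero (by omega)
  obtain ⟨D, hD⟩ := EdgeEnds.exists_isEndsOf hne
  let K : Finset β := (range (2 * m)).biUnion fun k => sumClass c k
  have hK : (K : Set β) ⊆ E(G) := by
    simp only [K, coe_biUnion, Set.iUnion_subset_iff]
    exact fun k _ => h.sumClass_subset
  refine ⟨G.restrict (K : Set β), ⟨restrict_le, rfl⟩, ?_, fun v hv =>
    (hD.edgeDegree_restrict_le K v).trans ?_⟩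
  · refine (hD.of_le restrict_le).isTreeConnected (V := hV.toFinset) (by simp) (by simpa) ?_
      (h.isConnectingPacking hD hV.coe_toFinset.symm hn)
    rw [edgeSet_restrict]
    exact Set.subset_inter hK subset_rfl
  · rw [EdgeEnds.deg, filter_biUnion]
    refine card_biUnion_le.trans ((sum_le_card_nsmul _ _ 1 fun k _ => ?_).trans_eq (by simp))
    exact h.deg_sumClass_le_one hD hv

end Complete

section IndependentSets

/-- A weighted Caro–Wei bound. By double counting, the closed neighbourhood of some `v` carries at
most the weight of `v` in terms of `g`; take `v` and continue outside this neighbourhood. -/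
lemma exists_independent_sum_le {ι : Type*} {r : ι → ι → Prop} [DecidableRel r] (hrefl : ∀ u, r u u)
    (hsymm : ∀ u v, r u v → r v u) {w g : ι → ℝ} (s : Finset ι) (hg : ∀ u ∈ s, 0 ≤ g u)
    (hw : ∀ u ∈ s, g u * #{v ∈ s | r u v} ≤ w u) :
    ∃ J ⊆ s, (J : Set ι).Pairwise (fun u v => ¬ r u v) ∧ ∑ u ∈ s, g u ≤ ∑ u ∈ J, w u := by
  induction s using Finset.strongInduction with
  | H s ih =>
    rcases s.eq_empty_or_nonempty with rfl | hs
    · exact ⟨∅, by simp⟩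
    have hdouble : ∑ v ∈ s, ∑ u ∈ s with r u v, g u ≤ ∑ v ∈ s, w v := by
      calc ∑ v ∈ s, ∑ u ∈ s with r u v, g u
        _ = ∑ u ∈ s, ∑ v ∈ s with r u v, g u := by
          simp only [sum_filter]
          exact sum_comm
        _ = ∑ u ∈ s, g u * #{v ∈ s | r u v} := by simp [mul_comm]
        _ ≤ ∑ v ∈ s, w v := sum_le_sum hw
    obtain ⟨v, hv, hvw⟩ := exists_le_of_sum_le hs hdouble
    have hrest : {u ∈ s | ¬ r u v} ⊂ s := filter_ssubset.2 ⟨v, hv, not_not.2 (hrefl v)⟩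
    obtain ⟨J, hJ, hind, hle⟩ := ih _ hrest (fun u hu => hg u (hrest.1 hu)) fun u hu =>
      (mul_le_mul_of_nonneg_left
        (mod_cast card_le_card (filter_subset_filter _ hrest.1)) (hg u (hrest.1 hu))).trans
        (hw u (hrest.1 hu))
    have hJv : ∀ u ∈ J, ¬ r u v := fun u hu => (mem_filter.1 (hJ hu)).2
    refine ⟨insert v J, insert_subset hv (hJ.trans hrest.1), ?_, ?_⟩
    · rw [coe_insert, Set.pairwise_insert]
      exact ⟨hind, fun u hu _ => ⟨fun h => hJv u hu (hsymm _ _ h), hJv u hu⟩⟩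
    · rw [sum_insert fun hvJ => hJv v hvJ (hrefl v), ← sum_filter_add_sum_filter_not s (r · v)]
      exact add_le_add hvw hle

lemma sub_half_mul_le {m d : ℕ} (hm : 1 ≤ m) (hd : m = 1 → d = 0) :
    ((m : ℝ) - d / 2) * (d + 1) ≤ (m : ℝ) ^ 2 + m - 1 - d := by
  suffices (0 : ℤ) ≤ (d : ℤ) ^ 2 - (2 * m + 1) * d + 2 * (m : ℤ) ^ 2 - 2 by
    have hreal : (0 : ℝ) ≤ (d : ℝ) ^ 2 - (2 * m + 1) * d + 2 * (m : ℝ) ^ 2 - 2 := mod_cast this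
    linarith
  rcases Nat.lt_or_ge m 3 with hlt | hge
  · interval_cases m
    · simp [hd rfl]
    · rcases Nat.lt_or_ge d 3 with hd_lt | hd_ge
      · interval_cases d <;> norm_num
      · zify at hd_ge
        push_cast
        nlinarith
  · zify at hge
    nlinarith [sq_nonneg (2 * (d : ℤ) - (2 * m + 1))]

namespace EdgeEnds

variable {α β : Type*} {D : EdgeEnds α β} {H : Finset β} {V : Finset α} {m : ℕ} {x y : α}

/-- Some edge of `H` has the ends `x` and `y`. -/
def Joined (D : EdgeEnds α β) (H : Finset β) (x y : α) : Prop :=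
  ∃ e ∈ H, (D.src e = x ∧ D.tgt e = y) ∨ (D.src e = y ∧ D.tgt e = x)

lemma Joined.symm (h : D.Joined H x y) : D.Joined H y x :=
  h.imp fun _ he => ⟨he.1, he.2.symm⟩

lemma card_le_deg_add_one (hV : ∀ y ∈ V, x = y ∨ D.Joined H x y) : #V ≤ D.deg H x + 1 := by
  have hsub : V ⊆
      insert x (({e ∈ H | D.src e = x ∨ D.tgt e = x} : Finset β).image fun e =>
        if D.src e = x then D.tgt e else D.src e) := by
    intro y hy
    rcases hV y hy with rfl | ⟨e, he, ⟨hsrc, htgt⟩ | ⟨hsrc, htgt⟩⟩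
    · exact mem_insert_self _ _
    · exact mem_insert_of_mem
        (mem_image.2 ⟨e, mem_filter.2 ⟨he, Or.inl hsrc⟩, by rw [if_pos hsrc, htgt]⟩)
    · refine mem_insert_of_mem (mem_image.2 ⟨e, mem_filter.2 ⟨he, Or.inr htgt⟩, ?_⟩)
      split_ifs with h
      exacts [htgt.trans (h.symm.trans hsrc), hsrc]
  exact (card_le_card hsub).trans
    ((card_insert_le _ _).trans (Nat.add_le_add_right card_image_le 1))

/-- Every vertex of degree `d` has the charge `m - d / 2`. Vertices of degree more than `2 m` have
a negative charge and are discarded; the Caro–Wei bound applies to the others. -/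
theorem exists_not_joined_le_sum (hm : 1 ≤ m) (hloop : ∀ e ∈ H, D.src e ≠ D.tgt e)
    (hV : D.EndsIn H V) (hone : m = 1 → H = ∅) :
    ∃ J ⊆ V, (J : Set α).Pairwise (fun x y => ¬ D.Joined H x y) ∧
      (m : ℝ) * #V - #H ≤ ∑ x ∈ J, ((m : ℝ) ^ 2 + m - 1 - D.deg H x) := by
  have hcharge : ∑ x ∈ V, ((m : ℝ) - D.deg H x / 2) = m * #V - #H := by
    have hsum : ∑ x ∈ V, (D.deg H x : ℝ) = 2 * #H := mod_cast sum_deg_eq_two_mul_card hloop hV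
    rw [sum_sub_distrib, ← sum_div, hsum, sum_const, nsmul_eq_mul]
    ring
  obtain ⟨J, hJ, hind, hle⟩ := exists_independent_sum_le
    (r := fun x y => x = y ∨ D.Joined H x y) (g := fun x => (m : ℝ) - D.deg H x / 2)
    (w := fun x => (m : ℝ) ^ 2 + m - 1 - D.deg H x) (fun _ => Or.inl rfl)
    (fun _ _ h => h.imp Eq.symm Joined.symm) {x ∈ V | 0 ≤ (m : ℝ) - D.deg H x / 2}
    (fun x hx => (mem_filter.1 hx).2) fun x hx => by
      refine (mul_le_mul_of_nonneg_left ?_ (mem_filter.1 hx).2).trans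
        (sub_half_mul_le hm fun h => by simp [hone h, deg])
      norm_cast
      exact card_le_deg_add_one fun y hy => (mem_filter.1 hy).2
  refine ⟨J, hJ.trans (filter_subset _ _), hind.imp fun _ _ h => (not_or.1 h).2, ?_⟩
  have hneg : ∑ x ∈ V with ¬ 0 ≤ (m : ℝ) - D.deg H x / 2, ((m : ℝ) - D.deg H x / 2) ≤ 0 :=
    sum_nonpos fun x hx => (not_le.1 (mem_filter.1 hx).2).le
  rw [← hcharge, ← sum_filter_add_sum_filter_not V fun x => 0 ≤ (m : ℝ) - D.deg H x / 2]
  exact (add_le_of_nonpos_right hneg).trans hle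

end EdgeEnds

end IndependentSets

section Toughness

variable {α β : Type*} {G : Graph α β} {t : ℝ} {V S A W : Finset α} {J : Finset (Finset α)}
  {x y : α}

lemma card_le_numComponents (hV : V(G).Finite) (hne : ∀ A ∈ J, A.Nonempty)
    (hsub : ∀ A ∈ J, (A : Set α) ⊆ V(G)) (hdisj : (J : Set (Finset α)).PairwiseDisjoint id)
    (hclosed : ∀ A ∈ J, ∀ x ∈ A, ∀ y, G.Adj x y → y ∈ A) : #J ≤ G.numComponents := by
  have hreach {A : Finset α} (hA : A ∈ J) {x y : α} (hx : x ∈ A) (h : G.Reachable x y) :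
      y ∈ A := by
    induction h with
    | refl => exact hx
    | tail _ hadj ih => exact hclosed A hA _ ih _ hadj
  have hcomp : ∀ A ∈ J, ∃ C ∈ G.componentSets, C.Nonempty ∧ C ⊆ A := fun A hA => by
    obtain ⟨x, hx⟩ := hne A hA
    exact ⟨_, ⟨x, hsub A hA hx, rfl⟩, ⟨x, hsub A hA hx, .refl⟩, fun y hy => hreach hA hx hy.2⟩
  choose! C hC hCne hCsub using hcomp
  rw [numComponents, ← Set.ncard_coe_finset]
  refine Set.ncard_le_ncard_of_injOn C hC (fun A hA B hB hAB => ?_) (hV.finite_subsets.subset ?_)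
  · obtain ⟨x, hx⟩ := hCne A hA
    by_contra hne
    exact disjoint_left.1 (hdisj hA hB hne) (hCsub A hA hx) (hCsub B hB (hAB ▸ hx))
  · rintro _ ⟨x, -, rfl⟩ y hy
    exact hy.1

/-- The neighbours in `W` of the vertices of `A`, except those in `A` itself. -/
noncomputable def vertexBoundary (G : Graph α β) (W A : Finset α) : Finset α :=
  {y ∈ W \ A | ∃ x ∈ A, G.Adj x y}

lemma mem_vertexBoundary :
    y ∈ vertexBoundary G W A ↔ (y ∈ W ∧ y ∉ A) ∧ ∃ x ∈ A, G.Adj x y := by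
  rw [vertexBoundary, mem_filter, mem_sdiff]

lemma vertexBoundary_subset : vertexBoundary G W A ⊆ W :=
  (filter_subset _ _).trans sdiff_subset

/-- Deleting `S` and the boundaries of the members of `J` leaves each member of `J` as a union of
components. -/
lemma mul_card_le_of_isTough (hG : IsTough t G) (ht : 0 < t) (hV : V(G) = V) (hS : S ⊆ V)
    (hJ : 2 ≤ #J) (hne : ∀ A ∈ J, A.Nonempty) (hsub : ∀ A ∈ J, A ⊆ V \ S)
    (hdisj : (J : Set (Finset α)).PairwiseDisjoint id)
    (hsep : ∀ A ∈ J, ∀ B ∈ J, A ≠ B → Disjoint A (vertexBoundary G (V \ S) B)) :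
    t * #J ≤ #(S ∪ J.biUnion (vertexBoundary G (V \ S))) := by
  set T : Finset α := S ∪ J.biUnion (vertexBoundary G (V \ S)) with hT
  have hTV : T ⊆ V := union_subset hS
    (biUnion_subset.2 fun A _ => vertexBoundary_subset.trans sdiff_subset)
  have hcomp : #J ≤ (G.deleteVerts (T : Set α)).numComponents := by
    refine card_le_numComponents ?_ hne (fun A hA x hx => ?_) hdisj fun A hA x hx y hadj => ?_
    · rw [vertexSet_deleteVerts, hV]
      exact V.finite_toSet.sdiff
    · obtain ⟨hxV, hxS⟩ := mem_sdiff.1 (hsub A hA hx)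
      rw [vertexSet_deleteVerts, hV]
      refine ⟨hxV, fun hxT => ?_⟩
      obtain ⟨B, hB, hxB⟩ := mem_biUnion.1 ((mem_union.1 hxT).resolve_left hxS)
      refine disjoint_left.1 (hsep A hA B hB ?_) hx hxB
      rintro rfl
      exact (mem_vertexBoundary.1 hxB).1.2 hx
    · obtain ⟨e, he⟩ := hadj
      have hy := he.right_mem
      rw [vertexSet_deleteVerts, hV] at hy
      have hyT : y ∉ T := hy.2
      rw [hT, mem_union, not_or] at hyT
      by_contra hyA
      exact hyT.2 (mem_biUnion.2 ⟨A, hA, mem_vertexBoundary.2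
        ⟨⟨mem_sdiff.2 ⟨hy.1, hyT.1⟩, hyA⟩, x, hx, e, he.mono deleteVerts_le⟩⟩)
  have htough := hG T (hV ▸ coe_subset.2 hTV)
  rw [Set.ncard_coe_finset] at htough
  have hJ' : (2 : ℝ) ≤ #J := mod_cast hJ
  have hcomp' : (#J : ℝ) ≤ (G.deleteVerts (T : Set α)).numComponents := mod_cast hcomp
  rcases le_max_iff.1 (hcomp'.trans htough) with hle | hle
  · linarith
  · rwa [one_div, inv_mul_eq_div, le_div_iff₀' ht] at hle

lemma two_mul_le_of_isTough (hG : IsTough t G) (ht : 0 < t) (hV : V(G) = V)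
    (hS : S ⊆ V) (hA : A.Nonempty) (hAS : A ⊆ V \ S)
    (hne : ¬ (V \ S) \ A ⊆ vertexBoundary G (V \ S) A) :
    2 * t ≤ #S + #(vertexBoundary G (V \ S) A) := by
  set N := vertexBoundary G (V \ S) with hN
  let B := ((V \ S) \ A) \ N A
  have hB : B.Nonempty := sdiff_nonempty.2 hne
  have hAB : Disjoint A B := disjoint_sdiff.mono_right sdiff_subset
  have hAB_ne : A ≠ B := hAB.ne hA.ne_empty
  have hNB : N B ⊆ N A := fun y hy => by
    obtain ⟨⟨hyW, hyB⟩, x, hxB, hadj⟩ := mem_vertexBoundary.1 hy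
    obtain ⟨hx, hxN⟩ := mem_sdiff.1 hxB
    obtain ⟨hxW, hxA⟩ := mem_sdiff.1 hx
    by_contra hyN
    by_cases hyA : y ∈ A
    · exact hxN (mem_vertexBoundary.2 ⟨⟨hxW, hxA⟩, y, hyA, hadj.symm⟩)
    · exact hyB (mem_sdiff.2 ⟨mem_sdiff.2 ⟨hyW, hyA⟩, hyN⟩)
  have hANA : Disjoint A (N A) := disjoint_sdiff.mono_right (filter_subset _ _)
  have hle := mul_card_le_of_isTough hG ht hV hS (J := {A, B}) (card_pair hAB_ne).ge
    (by simp [hA, hB]) (by simp [hAS, B, sdiff_subset.trans sdiff_subset])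
    (by simpa [Set.PairwiseDisjoint, Set.pairwise_pair, hAB_ne, hAB.symm] using ⟨hAB, hAB.symm⟩)
    (by
      simp only [mem_insert, mem_singleton]
      rintro _ (rfl | rfl) _ (rfl | rfl) hne
      exacts [absurd rfl hne, hANA.mono_right hNB, sdiff_disjoint, absurd rfl hne])
  rw [card_pair hAB_ne, biUnion_insert, singleton_biUnion, ← hN, union_eq_left.2 hNB] at hle
  calc 2 * t
    _ = t * (2 : ℕ) := by rw [mul_comm, Nat.cast_ofNat]
    _ ≤ #(S ∪ N A) := hle
    _ ≤ #S + #(N A) := mod_cast card_union_le S (N A)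

lemma two_mul_add_two_le_of_isTough (hG : IsTough t G) (ht : 0 < t) (hV : V(G) = V) (hx : x ∈ V)
    (hy : y ∈ V) (hxy : x ≠ y) (hadj : ¬ G.Adj x y) : 2 * t + 2 ≤ #V := by
  have hpair : ({x, y} : Finset α) ⊆ V := insert_subset hx (singleton_subset_iff.2 hy)
  have hrest : V \ (V \ {x, y}) = {x, y} := Finset.sdiff_sdiff_eq_self hpair
  have hempty : vertexBoundary G {x, y} {x} = ∅ := by
    ext z
    simp only [mem_vertexBoundary, mem_insert, mem_singleton, exists_eq_left, notMem_empty,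
      iff_false]
    rintro ⟨⟨rfl | rfl, hz⟩, hxz⟩
    exacts [hz rfl, hadj hxz]
  have hle := two_mul_le_of_isTough hG ht hV (S := V \ {x, y}) (A := {x})
    sdiff_subset (singleton_nonempty x) (by simp [hrest]) (by
      rw [hrest, hempty, subset_empty, sdiff_eq_empty_iff_subset]
      exact fun h => hxy.symm (mem_singleton.1 (h (by simp))))
  rw [hrest, hempty, card_empty, Nat.cast_zero, add_zero] at hle
  have hcard : (#(V \ {x, y}) : ℝ) + 2 = #V :=
    mod_cast card_pair hxy ▸ card_sdiff_add_card_eq_card hpair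
  linarith

end Toughness

section StrongToughness

namespace EdgeEnds

variable {α β : Type*} {D : EdgeEnds α β} {G : Graph α β} {m : ℕ} {V S A W : Finset α}
  {J : Finset (Finset α)} {E I : Finset β} {t : ℝ} {x y : α}

/-- The edges of `E` with exactly one end in `A`. -/
noncomputable def boundary (D : EdgeEnds α β) (E : Finset β) (A : Finset α) : Finset β :=
  {e ∈ E | ¬ (D.src e ∈ A ↔ D.tgt e ∈ A)}

lemma EndsIn.boundary_sdiff (hE : D.EndsIn E V) (A : Finset α) :
    D.boundary E (V \ A) = D.boundary E A :=
  filter_congr fun e he => by simp [hE e he, not_iff_not]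

lemma Joined.map {ι : Type*} {p : α → ι} (h : D.Joined E x y) (hp : p x ≠ p y) :
    (D.map p).Joined (D.crossing p E) (p x) (p y) := by
  obtain ⟨e, he, ⟨rfl, rfl⟩ | ⟨rfl, rfl⟩⟩ := h
  exacts [⟨e, mem_crossing.2 ⟨he, hp⟩, Or.inl ⟨rfl, rfl⟩⟩,
    ⟨e, mem_crossing.2 ⟨he, hp.symm⟩, Or.inr ⟨rfl, rfl⟩⟩]

lemma Represents.joined_of_adj (h : D.Represents G V E) (hx : x ∈ W) (hy : y ∈ W)
    (hadj : G.Adj x y) : D.Joined (D.inside E W) x y := by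
  obtain ⟨e, he⟩ := hadj
  have heE := h.mem_of_isLink he
  have hends := h.isEndsOf.eq_or_eq he
  refine ⟨e, mem_inside.2 ⟨heE, ?_⟩, hends⟩
  rcases hends with ⟨rfl, rfl⟩ | ⟨rfl, rfl⟩
  exacts [⟨hx, hy⟩, ⟨hy, hx⟩]

lemma Represents.card_vertexBoundary_le (h : D.Represents G V E) (hA : A ⊆ W) :
    #(vertexBoundary G W A) ≤ #(D.boundary (D.inside E W) A) := by
  refine (card_le_card fun y hy => ?_).trans (card_image_le (s := D.boundary (D.inside E W) A)
    (f := fun e => if D.src e ∈ A then D.tgt e else D.src e))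
  obtain ⟨⟨hyW, hyA⟩, x, hx, hadj⟩ := mem_vertexBoundary.1 hy
  obtain ⟨e, he, hends⟩ := h.joined_of_adj (hA hx) hyW hadj
  refine mem_image.2 ⟨e, ?_⟩
  rcases hends with ⟨rfl, rfl⟩ | ⟨rfl, rfl⟩ <;> simp [boundary, he, hx, hyA]

/-- Every pair in `A × (W \ A)` is the pair of ends of an edge. -/
lemma Represents.card_mul_card_sdiff_le (h : D.Represents G V E) (hWV : W ⊆ V)
    (hG : ∀ x ∈ V(G), ∀ y ∈ V(G), x ≠ y → G.Adj x y) (hA : A ⊆ W) :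
    #A * #(W \ A) ≤ #(D.boundary (D.inside E W) A) := by
  rw [← card_product]
  refine (card_le_card fun p hp => ?_).trans (card_image_le (s := D.boundary (D.inside E W) A)
    (f := fun e => if D.src e ∈ A then (D.src e, D.tgt e) else (D.tgt e, D.src e)))
  obtain ⟨x, y⟩ := p
  obtain ⟨hx, hy⟩ := mem_product.1 hp
  obtain ⟨hyW, hyA⟩ := mem_sdiff.1 hy
  have hmem {z : α} (hz : z ∈ W) : z ∈ V(G) := h.vertexSet_eq ▸ mem_coe.2 (hWV hz)
  obtain ⟨e, he, hends⟩ := h.joined_of_adj (hA hx) hyW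
    (hG x (hmem (hA hx)) y (hmem hyW) fun hxy => hyA (hxy ▸ hx))
  refine mem_image.2 ⟨e, ?_⟩
  rcases hends with ⟨rfl, rfl⟩ | ⟨rfl, rfl⟩ <;> simp only at hx hyA <;>
    simp [boundary, he, hx, hyA]

lemma Sparse.crossing_part_eq_empty (hI : D.Sparse 1 I) (hV : D.EndsIn I V) :
    D.crossing (D.part 1 I V) I = ∅ := by
  refine eq_empty_of_forall_notMem fun e he => ?_
  obtain ⟨he, hne⟩ := mem_crossing.1 he
  have hpair : D.Tight 1 I {D.src e, D.tgt e} := by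
    have hle := hI {D.src e, D.tgt e} (insert_nonempty _ _)
    have hpos : 0 < #(D.inside I {D.src e, D.tgt e}) :=
      card_pos.2 ⟨e, mem_inside.2 ⟨he, by simp⟩⟩
    rw [card_pair (hI.src_ne_tgt he)] at hle
    refine ⟨insert_nonempty _ _, ?_⟩
    rw [card_pair (hI.src_ne_tgt he)]
    omega
  have hends : ({D.src e, D.tgt e} : Finset α) ⊆ V :=
    insert_subset (hV e he).1 (singleton_subset_iff.2 (hV e he).2)
  exact hne (hI.part_eq_of_tight hpair hends (by simp) (by simp))

lemma deg_map_crossing {ι : Type*} {p : α → ι} {i : ι} (hE : D.EndsIn E V)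
    (hA : ∀ x ∈ V, p x = i ↔ x ∈ A) : (D.map p).deg (D.crossing p E) i = #(D.boundary E A) := by
  refine congrArg card (ext fun e => mem_filter.trans ?_)
  rw [mem_crossing, boundary, mem_filter, and_assoc]
  refine and_congr_right fun he => ?_
  rw [← hA _ (hE e he).1, ← hA _ (hE e he).2]
  constructor
  · rintro ⟨hne, hsrc | htgt⟩ h
    exacts [hne (hsrc.trans (h.1 hsrc).symm), hne ((h.2 htgt).trans htgt.symm)]
  · intro h
    refine ⟨fun heq => h (by rw [heq]), ?_⟩
    by_contra hno
    exact h (iff_of_false (not_or.1 hno).1 (not_or.1 hno).2)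

lemma endsIn_crossing :
    (D.map (D.part m I W)).EndsIn (D.crossing (D.part m I W) (D.inside E W)) (D.parts m I W) :=
  fun e he => by
    obtain ⟨hsrc, htgt⟩ := endsIn_inside e (mem_crossing.1 he).1
    exact ⟨mem_parts.2 ⟨_, hsrc, rfl⟩, mem_parts.2 ⟨_, htgt, rfl⟩⟩

lemma Sparse.deg_map_part (hI : D.Sparse m I) (hE : D.EndsIn E V) (hA : A ∈ D.parts m I V) :
    (D.map (D.part m I V)).deg (D.crossing (D.part m I V) E) A = #(D.boundary E A) :=
  deg_map_crossing hE fun _ hx => ⟨fun h => h ▸ hI.mem_part hx, hI.part_eq_of_mem_parts hA⟩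

lemma IsSparseBasis.sum_card_boundary (hI : D.IsSparseBasis m W (D.inside E W) I) :
    ∑ A ∈ D.parts m I W, #(D.boundary (D.inside E W) A) =
      2 * #(D.crossing (D.part m I W) (D.inside E W)) := by
  rw [← sum_deg_eq_two_mul_card (D := D.map (D.part m I W)) (V := D.parts m I W)
    (fun e he => (mem_crossing.1 he).2) endsIn_crossing]
  exact sum_congr rfl fun A hA => (hI.sparse.deg_map_part endsIn_inside hA).symm

/-- Apply the weighted Caro–Wei bound to the graph that arises by contracting the parts. -/
lemma IsSparseBasis.exists_disjoint_vertexBoundary (h : D.Represents G V E)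
    (hI : D.IsSparseBasis m W (D.inside E W) I) (hm : 1 ≤ m) :
    ∃ J ⊆ D.parts m I W,
      (∀ A ∈ J, ∀ B ∈ J, A ≠ B → Disjoint A (vertexBoundary G W B)) ∧
      (m : ℝ) * #(D.parts m I W) - #(D.crossing (D.part m I W) (D.inside E W)) ≤
        ∑ A ∈ J, ((m : ℝ) ^ 2 + m - 1 - #(D.boundary (D.inside E W) A)) := by
  obtain ⟨J, hJ, hind, hle⟩ := exists_not_joined_le_sum (D := D.map (D.part m I W))
    (H := D.crossing (D.part m I W) (D.inside E W)) (V := D.parts m I W) hm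
    (fun e he => (mem_crossing.1 he).2) endsIn_crossing
    (by
      rintro rfl
      rw [hI.crossing_eq]
      exact hI.sparse.crossing_part_eq_empty (endsIn_inside.mono hI.subset))
  refine ⟨J, hJ, fun A hA B hB hAB => disjoint_left.2 fun y hyA hyB => ?_, ?_⟩
  · obtain ⟨⟨hyW, -⟩, x, hxB, hadj⟩ := mem_vertexBoundary.1 hyB
    have hpx := hI.sparse.part_eq_of_mem_parts (hJ hB) hxB
    have hpy := hI.sparse.part_eq_of_mem_parts (hJ hA) hyA
    have hjoin := (h.joined_of_adj (subset_of_mem_parts (hJ hB) hxB) hyW hadj).map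
      (p := D.part m I W) (by rw [hpx, hpy]; exact hAB.symm)
    rw [hpx, hpy] at hjoin
    exact hind hA hB hAB hjoin.symm
  · refine hle.trans_eq (sum_congr rfl fun A hA => ?_)
    rw [hI.sparse.deg_map_part endsIn_inside (hJ hA)]

lemma Represents.le_card_add_card_boundary_of_isTough (h : D.Represents G V E)
    (hG : IsTough t G) (ht : 0 < t) (hV : 2 * t ≤ #V) (hS : S ⊆ V) (hA : A.Nonempty)
    (hAS : A ⊆ V \ S) (hrest : ((V \ S) \ A).Nonempty) :
    t ≤ #S + #(D.boundary (D.inside E (V \ S)) A) := by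
  by_contra! hlt
  set d := D.boundary (D.inside E (V \ S))
  have hcover {B : Finset α} (hB : B.Nonempty) (hBS : B ⊆ V \ S) (hd : d B = d A) :
      #((V \ S) \ B) ≤ #(d A) := by
    have hle : #(vertexBoundary G (V \ S) B) ≤ #(d A) :=
      (h.card_vertexBoundary_le hBS).trans_eq (congrArg card hd)
    refine (card_le_card ?_).trans hle
    by_contra hsub
    have htwo := two_mul_le_of_isTough hG ht h.vertexSet_eq hS hB hBS hsub
    have hle' : (#(vertexBoundary G (V \ S) B) : ℝ) ≤ #(d A) := mod_cast hle
    linarith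
  have hout := hcover hA hAS rfl
  have hin := hcover hrest sdiff_subset (endsIn_inside.boundary_sdiff A)
  rw [Finset.sdiff_sdiff_eq_self hAS] at hin
  have hcard : #V ≤ #S + 2 * #(d A) := by
    have hW := card_sdiff_add_card_eq_card hAS
    have hVS := card_sdiff_add_card_eq_card hS
    omega
  have hcard' : (#V : ℝ) ≤ #S + 2 * #(d A) := mod_cast hcard
  linarith

lemma Represents.sum_sub_le_card_of_isTough (h : D.Represents G V E)
    (hG : IsTough t G) (ht : 0 < t) (hV : 2 * t ≤ #V) (hS : S ⊆ V)
    (hne : ∀ A ∈ J, A.Nonempty) (hsub : ∀ A ∈ J, A ⊂ V \ S)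
    (hdisj : (J : Set (Finset α)).PairwiseDisjoint id)
    (hsep : ∀ A ∈ J, ∀ B ∈ J, A ≠ B → Disjoint A (vertexBoundary G (V \ S) B)) :
    ∑ A ∈ J, (t - #(D.boundary (D.inside E (V \ S)) A)) ≤ #S := by
  rcases Nat.lt_or_ge #J 2 with hlt | htwo
  · rcases J.eq_empty_or_nonempty with rfl | hJ
    · simp
    · obtain ⟨A, rfl⟩ := card_eq_one.1 (le_antisymm (Nat.lt_succ_iff.1 hlt) hJ.card_pos)
      have hA := hsub A (mem_singleton_self A)
      have hle := h.le_card_add_card_boundary_of_isTough hG ht hV hS (hne A (mem_singleton_self A))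
        hA.1 (sdiff_nonempty.2 hA.2)
      rw [sum_singleton]
      linarith
  · have hle := mul_card_le_of_isTough hG ht h.vertexSet_eq hS htwo hne (fun A hA => (hsub A hA).1)
      hdisj hsep
    have hunion : #(S ∪ J.biUnion (vertexBoundary G (V \ S))) ≤
        #S + ∑ A ∈ J, #(D.boundary (D.inside E (V \ S)) A) :=
      (card_union_le _ _).trans (Nat.add_le_add_left (card_biUnion_le.trans
        (sum_le_sum fun A hA => h.card_vertexBoundary_le (hsub A hA).1)) _)
    have hunion' : (#(S ∪ J.biUnion (vertexBoundary G (V \ S))) : ℝ) ≤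
        #S + ∑ A ∈ J, (#(D.boundary (D.inside E (V \ S)) A) : ℝ) := mod_cast hunion
    rw [sum_sub_distrib, sum_const, nsmul_eq_mul]
    linarith

lemma Sparse.ssubset_of_mem_parts (hI : D.Sparse m I) (hP : 2 ≤ #(D.parts m I W))
    (hA : A ∈ D.parts m I W) : A ⊂ W := by
  refine (subset_of_mem_parts hA).ssubset_of_ne ?_
  rintro rfl
  obtain ⟨B, hB, hBA⟩ := exists_mem_ne hP A
  obtain ⟨x, hx⟩ := (hI.tight_of_mem_parts hB).1
  exact disjoint_left.1 (hI.pairwiseDisjoint_parts hB hA hBA) hx (subset_of_mem_parts hB hx)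

lemma IsSparseBasis.mul_card_parts_sub_le_of_isTough (h : D.Represents G V E)
    (hI : D.IsSparseBasis m (V \ S) (D.inside E (V \ S)) I) (hm : 1 ≤ m)
    (hG : IsTough ((m : ℝ) ^ 2 + m - 1) G) (hV : 2 * ((m : ℝ) ^ 2 + m - 1) ≤ #V) (hS : S ⊆ V)
    (hP : 2 ≤ #(D.parts m I (V \ S))) :
    (m : ℝ) * #(D.parts m I (V \ S)) -
      #(D.crossing (D.part m I (V \ S)) (D.inside E (V \ S))) ≤ #S := by
  obtain ⟨J, hJ, hsep, hle⟩ := hI.exists_disjoint_vertexBoundary h hm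
  have hm' : (1 : ℝ) ≤ m := mod_cast hm
  exact hle.trans (h.sum_sub_le_card_of_isTough hG (by nlinarith) hV hS
    (fun A hA => (hI.sparse.tight_of_mem_parts (hJ hA)).1)
    (fun A hA => hI.sparse.ssubset_of_mem_parts hP (hJ hA))
    (hI.sparse.pairwiseDisjoint_parts.subset (coe_subset.2 hJ)) hsep)

/-- `#A * #(W \ A) ≥ #W - 1` for every nonempty proper subset `A` of `W`. -/
lemma IsSparseBasis.card_parts_mul_card_le_of_complete (h : D.Represents G V E)
    (hI : D.IsSparseBasis m W (D.inside E W) I) (hWV : W ⊆ V)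
    (hG : ∀ x ∈ V(G), ∀ y ∈ V(G), x ≠ y → G.Adj x y) (hP : 2 ≤ #(D.parts m I W)) :
    #(D.parts m I W) * #W ≤
      2 * #(D.crossing (D.part m I W) (D.inside E W)) + #(D.parts m I W) := by
  have hboundary : ∀ A ∈ D.parts m I W, #W ≤ #(D.boundary (D.inside E W) A) + 1 := fun A hA => by
    have hAW := hI.sparse.ssubset_of_mem_parts hP hA
    have hmul := h.card_mul_card_sdiff_le hWV hG hAW.1
    have hA_pos : 1 ≤ #A := (hI.sparse.tight_of_mem_parts hA).1.card_pos
    have hrest_pos : 1 ≤ #(W \ A) := (sdiff_nonempty.2 hAW.2).card_pos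
    have hcard := card_sdiff_add_card_eq_card hAW.1
    nlinarith
  rw [← hI.sum_card_boundary, ← smul_eq_mul, ← sum_const]
  refine (sum_le_sum hboundary).trans_eq ?_
  rw [sum_add_distrib, card_eq_sum_ones]

/-- The right-hand side minus the left-hand side is at least `(n - m - 1) * (n - m - 2) / 2` when
`N = n`, and it does not decrease with `N`. -/
lemma mul_le_add_of_mul_le {m n N c s : ℕ} (hn : 2 ≤ n) (hnN : n ≤ N) (hc : n * N ≤ 2 * c + n)
    (hs : m ^ 2 + 3 * m + 2 ≤ 2 * (N + s)) : m * n ≤ s + c := by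
  have hquad : 0 ≤ ((n : ℤ) - m - 1) * (n - m - 2) := by
    rcases le_or_gt (n : ℤ) (m + 1) with hle | hgt <;> nlinarith
  zify at hn hnN hc hs ⊢
  nlinarith [mul_nonneg (sub_nonneg.2 hnN) (sub_nonneg.2 hn)]

lemma IsSparseBasis.mul_card_parts_le_of_complete (h : D.Represents G V E)
    (hI : D.IsSparseBasis m (V \ S) (D.inside E (V \ S)) I) (hS : S ⊆ V)
    (hG : ∀ x ∈ V(G), ∀ y ∈ V(G), x ≠ y → G.Adj x y) (hV : m ^ 2 + 3 * m + 2 ≤ 2 * #V)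
    (hP : 2 ≤ #(D.parts m I (V \ S))) :
    m * #(D.parts m I (V \ S)) ≤
      #S + #(D.crossing (D.part m I (V \ S)) (D.inside E (V \ S))) :=
  mul_le_add_of_mul_le hP card_image_le
    (hI.card_parts_mul_card_le_of_complete h sdiff_subset hG hP)
    (by rwa [card_sdiff_add_card_eq_card hS])

lemma Represents.mul_Omega_deleteVerts_le (h : D.Represents G V E) (hm : 1 ≤ m)
    (hG : IsTough ((m : ℝ) ^ 2 + m - 1) G)
    (hV : ((m : ℝ) ^ 2 + 3 * m + 2) / 2 ≤ #V ∨ ¬ ∀ x ∈ V(G), ∀ y ∈ V(G), x ≠ y → G.Adj x y)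
    (hS : S ⊆ V) :
    m * Omega m (G.deleteVerts (S : Set α)) ≤ m ∨ m * Omega m (G.deleteVerts (S : Set α)) ≤ #S := by
  obtain ⟨I, hI⟩ := exists_isSparseBasis m (D.endsIn_inside (I := E) (X := V \ S))
  have hcard : (#I : ℝ) + m * #(D.parts m I (V \ S)) =
      m * #(V \ S) + #(D.crossing (D.part m I (V \ S)) (D.inside E (V \ S))) :=
    mod_cast hI.card_add endsIn_inside
  have hOmega := (h.deleteVerts S).mul_Omega hI hm
  rcases Nat.lt_or_ge #(D.parts m I (V \ S)) 2 with hlt | hP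
  · left
    have hle : (#(D.parts m I (V \ S)) : ℝ) ≤ 1 := mod_cast Nat.lt_succ_iff.1 hlt
    have hm' : (m : ℝ) * #(D.parts m I (V \ S)) ≤ m := mul_le_of_le_one_right m.cast_nonneg hle
    have hc : (0 : ℝ) ≤ #(D.crossing (D.part m I (V \ S)) (D.inside E (V \ S))) :=
      Nat.cast_nonneg _
    linarith
  right
  by_cases hcomplete : ∀ x ∈ V(G), ∀ y ∈ V(G), x ≠ y → G.Adj x y
  · have hle := hV.resolve_right (not_not.2 hcomplete)
    rw [div_le_iff₀' two_pos] at hle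
    have hle' := hI.mul_card_parts_le_of_complete h hS hcomplete (mod_cast hle) hP
    have hcast : (m : ℝ) * #(D.parts m I (V \ S)) ≤
        #S + #(D.crossing (D.part m I (V \ S)) (D.inside E (V \ S))) := mod_cast hle'
    linarith
  · push Not at hcomplete
    obtain ⟨x, hx, y, hy, hxy, hadj⟩ := hcomplete
    rw [h.vertexSet_eq] at hx hy
    have hm' : (1 : ℝ) ≤ m := mod_cast hm
    have hle := two_mul_add_two_le_of_isTough hG (by nlinarith) h.vertexSet_eq hx hy hxy hadj
    have hlt := hI.mul_card_parts_sub_le_of_isTough h hm hG (by linarith) hS hP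
    linarith

end EdgeEnds

variable {α β : Type*} {G : Graph α β} {m : ℕ}

theorem isStronglyTough_of_isTough (hm : 1 ≤ m) (hV : V(G).Finite) (hE : E(G).Finite)
    (hG : IsTough ((m : ℝ) ^ 2 + m - 1) G)
    (hcard : ((m : ℝ) ^ 2 + 3 * m + 2) / 2 ≤ V(G).ncard ∨
      ¬ ∀ x ∈ V(G), ∀ y ∈ V(G), x ≠ y → G.Adj x y) : IsStronglyTough m (m : ℝ) G := by
  have hm_pos : (0 : ℝ) < m := mod_cast hm
  have hne : V(G).Nonempty := by
    rcases hcard with hcard | hcard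
    · refine Set.nonempty_of_ncard_ne_zero fun hzero => ?_
      rw [hzero, Nat.cast_zero] at hcard
      nlinarith
    · push Not at hcard
      exact hcard.imp fun _ hx => hx.1
  obtain ⟨D, V, E, h⟩ := exists_represents hV hE hne
  intro S hSV
  have hncard : V(G).ncard = #V := by rw [h.vertexSet_eq, Set.ncard_coe_finset]
  rw [hncard] at hcard
  rw [h.vertexSet_eq] at hSV
  lift S to Finset α using V.finite_toSet.subset hSV
  rw [Set.ncard_coe_finset, one_div, inv_mul_eq_div, le_max_iff, le_div_iff₀' hm_pos]
  exact (h.mul_Omega_deleteVerts_le hm hG hcard (coe_subset.1 hSV)).imp_left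
    fun hle => le_of_mul_le_mul_left (by rwa [mul_one]) hm_pos

end StrongToughness

end TreeToughness

theorem mainTheorem7 {α β : Type*} (m : ℕ) (hm : 1 ≤ m) (G : Graph α β)
    (hloop : G.Loopless) (hV : G.vertexSet.Finite) (hE : G.edgeSet.Finite)
    (htough : Graph.IsTough ((m : ℝ) ^ 2 + m - 1) G) :
    (((m : ℝ) ^ 2 + 3 * m + 2) / 2 ≤ (G.vertexSet.ncard : ℝ) →
      Graph.IsStronglyTough m (m : ℝ) G) ∧
    (2 * m ≤ G.vertexSet.ncard →
      ∃ H : Graph α β, H ≤s G ∧ Graph.IsTreeConnected m H ∧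
        ∀ v ∈ H.vertexSet, H.edgeDegree v ≤ 2 * m + 1) := by
  refine ⟨fun hn => TreeToughness.isStronglyTough_of_isTough hm hV hE htough (Or.inl hn),
    fun hn => ?_⟩
  by_cases hcomplete : ∀ x ∈ G.vertexSet, ∀ y ∈ G.vertexSet, x ≠ y → G.Adj x y
  · obtain ⟨H, hH, htree, hdeg⟩ :=
      TreeToughness.exists_isTreeConnected_of_complete hm hV hcomplete hn
    exact ⟨H, hH, htree, fun v hv => (hdeg v hv).trans (Nat.le_succ _)⟩
  · exact TreeToughness.exists_isTreeConnected_of_isStronglyTough hm hV hE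
      (Set.nonempty_of_ncard_ne_zero (by omega))
      (TreeToughness.isStronglyTough_of_isTough hm hV hE htough (Or.inr hcomplete))
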